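/- Let $p\in\mathbb{C}[z_1,z_2]$ be a complex conic, i.e. a polynomial of total degree $2$; it is called a real conic if all its coefficients are real. Let $\mathcal{I}(p)=\{(\operatorname{Im} z_1,\operatorname{Im} z_2) : z\in\mathbb{C}^2,\ p(z)=0\}\subseteq\mathbb{R}^2$ be its imaginary projection and $\mathcal{I}(p)^{\mathsf c}=\mathbb{R}^2\setminus\mathcal{I}(p)$. Let $u(p)$ be the number of unbounded connected components of $\mathcal{I}(p)^{\mathsf c}$, and let $s(p)$ be the number of those unbounded components that are strictly convex, where a set $C\subseteq\mathbb{R}^2$ is strictly convex if the open segment between any two distinct points of the closure of $C$ lies in the interior of $C$ (so $C$ is convex and its boundary contains no line segment). 1. For complex conics, $u(p)$ takes exactly the values $0,1,2,3,4$: always $u(p)\le 4$, and each of these values is attained by some complex conic. Moreover the maximum of $s(p)$ over all complex conics is $4$ (and is attained). 2. For real conics, $u(p)$ takes exactly the values $0,2,3,4$: always $u(p)\le 4$ and $u(p)\ne 1$, and each of these values is attained by some real conic. Moreover the maximum of $s(p)$ over all real conics is $2$ (and is attained). -/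

import Mathlib

/-- The imaginary projection `I(p)`: the set of imaginary parts of the complex zeros of `p`. -/
def imaginaryProjection {n : ℕ} (p : MvPolynomial (Fin n) ℂ) : Set (Fin n → ℝ) :=
  (fun (z : Fin n → ℂ) (j : Fin n) => (z j).im) '' {z | MvPolynomial.eval z p = 0}

/-- A complex conic: a bivariate complex polynomial of total degree two. -/
def IsComplexConic (p : MvPolynomial (Fin 2) ℂ) : Prop :=
  p.totalDegree = 2

/-- A real conic: a complex conic all of whose coefficients are real. -/
def IsRealConic (p : MvPolynomial (Fin 2) ℂ) : Prop :=
  IsComplexConic p ∧ ∀ m, (p.coeff m).im = 0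

/-- The connected components of a set `S`, as subsets of the ambient space. -/
def components {X : Type*} [TopologicalSpace X] (S : Set X) : Set (Set X) :=
  {C | ∃ x ∈ S, C = connectedComponentIn S x}

/-- The unbounded connected components of the complement of `I(p)`. (All norms on `ℝ^n` give the
same topology and the same bounded sets.) -/
def unboundedComponents {n : ℕ} (p : MvPolynomial (Fin n) ℂ) : Set (Set (Fin n → ℝ)) :=
  {C ∈ components (imaginaryProjection p)ᶜ | ¬ Bornology.IsBounded C}

/-- Strict convexity: the open segment between any two distinct points of the closure of `C` lies
in the interior of `C`; equivalently, `C` is convex and its closure is strictly convex. It is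
the closure that matters: every open convex set (such as an open half-plane) satisfies
`StrictConvex` itself, although its boundary may contain segments. -/
def IsStrictlyConvex {n : ℕ} (C : Set (Fin n → ℝ)) : Prop :=
  ∀ x ∈ closure C, ∀ y ∈ closure C, x ≠ y → openSegment ℝ x y ⊆ interior C

/-- The strictly convex ones among the unbounded components of the complement of `I(p)`. -/
def strictlyConvexUnboundedComponents {n : ℕ} (p : MvPolynomial (Fin n) ℂ) :
    Set (Set (Fin n → ℝ)) :=
  {C ∈ unboundedComponents p | IsStrictlyConvex C}

/-! A real linear change of variables acts on imaginary parts by the same matrix, and a complex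
translation shifts them by its imaginary part. Neither affects the number of unbounded components or
strict convexity (`encard_parts_shadow_of_affine`), so only normal forms matter. These are governed
by the quadratic part, a product of two complex linear forms.

If one factor is not a scalar multiple of a real form, its real and imaginary parts serve as new
real coordinates, so that the factor becomes `u = z + I * w`; put `v = z - I * w`. Prescribing the
imaginary parts means `v = conj u - conj Y` for a given `Y`, and the conic becomes one equation in
`u`. For large `Y` this is solvable by contraction, so the complement is bounded and has no
unbounded component (`encard_parts_of_nonreal_factor`).

If both factors are multiples of real forms, there are three normal forms. Independent factors give
`z * w = c`, always with four unbounded components. They are bounded by hyperbola branches, and all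
strictly convex, when `c` is nonreal. For real `c ≠ 0` two of them are quadrants including their
axes but not the origin, so only two are strictly convex; for `c = 0` all four are open quadrants.
Dependent factors give `z ^ 2 = c`, whose complement consists of two or three strips and
half-planes, or `w = k * z ^ 2`. The last leaves two open rays for real `k`, and one region bounded
by a parabola for nonreal `k`. Hence the value 1 needs nonreal coefficients, as do more than two
strictly convex components. `encard_parts_quadratic` assembles these cases. -/

open Set ComplexConjugate MvPolynomial

/-! ### Identifying and counting unbounded components -/

/-- The unbounded connected components of `S`. -/
def unboundedParts {n : ℕ} (S : Set (Fin n → ℝ)) : Set (Set (Fin n → ℝ)) :=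
  {C ∈ components S | ¬ Bornology.IsBounded C}

/-- The strictly convex unbounded connected components of `S`. -/
def strictParts {n : ℕ} (S : Set (Fin n → ℝ)) : Set (Set (Fin n → ℝ)) :=
  {C ∈ unboundedParts S | IsStrictlyConvex C}

theorem strictParts_encard_le {n : ℕ} (S : Set (Fin n → ℝ)) :
    (strictParts S).encard ≤ (unboundedParts S).encard :=
  encard_le_encard (sep_subset _ _)

theorem unboundedParts_of_isBounded {n : ℕ} {S : Set (Fin n → ℝ)} (h : Bornology.IsBounded S) :
    unboundedParts S = ∅ := by
  ext C
  simp only [unboundedParts, components, mem_ofPred_eq, mem_empty_iff_false, iff_false, not_and,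
    not_not]
  rintro ⟨x, -, rfl⟩
  exact h.subset (connectedComponentIn_subset _ _)

/-- The disjoint open sets make each `S ∩ U i` relatively clopen in `S`, so a connected trace is a
whole component. The extra set `V` absorbs bounded leftovers. The traces themselves need not be open
in the plane. -/
theorem unboundedParts_eq_range {n : ℕ} {ι : Type*} {S V : Set (Fin n → ℝ)}
    {U : ι → Set (Fin n → ℝ)} (hU : ∀ i, IsOpen (U i)) (hV : IsOpen V)
    (hUU : ∀ i j, i ≠ j → Disjoint (U i) (U j)) (hUV : ∀ i, Disjoint (U i) V)
    (hS : S ⊆ (⋃ i, U i) ∪ V) (hb : Bornology.IsBounded (S ∩ V))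
    (hc : ∀ i, IsPreconnected (S ∩ U i)) (hu : ∀ i, ¬ Bornology.IsBounded (S ∩ U i)) :
    unboundedParts S = range fun i => S ∩ U i := by
  have key : ∀ i, ∀ x ∈ S ∩ U i, connectedComponentIn S x = S ∩ U i := by
    intro i x hx
    apply Subset.antisymm
    · refine subset_inter (connectedComponentIn_subset _ _) ?_
      -- Everything other than `U i` is lumped into one open set, so that a connected set meeting `U
      -- i` cannot leave it.
      have hW : IsOpen ((⋃ j, ⋃ (_ : j ≠ i), U j) ∪ V) :=
        (isOpen_iUnion fun j => isOpen_iUnion fun _ => hU j).union hV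
      refine IsPreconnected.subset_left_of_subset_union (hU i) hW ?_ ?_ ?_
        isPreconnected_connectedComponentIn
      · rw [disjoint_union_right, disjoint_iUnion_right]
        refine ⟨fun j => ?_, hUV i⟩
        rw [disjoint_iUnion_right]
        exact fun hj => hUU i j hj.symm
      · refine (connectedComponentIn_subset _ _).trans fun y hy => ?_
        rcases hS hy with h | h
        · obtain ⟨j, hj⟩ := mem_iUnion.1 h
          by_cases hji : j = i
          · exact Or.inl (hji ▸ hj)
          · exact Or.inr (Or.inl (mem_iUnion₂.2 ⟨j, hji, hj⟩))
        · exact Or.inr (Or.inr h)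
      · exact ⟨x, mem_connectedComponentIn hx.1, hx.2⟩
    · exact (hc i).subset_connectedComponentIn hx inter_subset_left
  ext C
  constructor
  · rintro ⟨⟨x, hx, rfl⟩, hC⟩
    rcases hS hx with h | h
    · obtain ⟨j, hj⟩ := mem_iUnion.1 h
      exact ⟨j, (key j x ⟨hx, hj⟩).symm⟩
    · refine absurd (hb.subset (subset_inter (connectedComponentIn_subset _ _) ?_)) hC
      refine IsPreconnected.subset_right_of_subset_union (isOpen_iUnion hU) hV ?_
        ((connectedComponentIn_subset _ _).trans hS) ⟨x, mem_connectedComponentIn hx, h⟩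
        isPreconnected_connectedComponentIn
      rw [disjoint_iUnion_left]
      exact hUV
  · rintro ⟨i, rfl⟩
    refine ⟨?_, hu i⟩
    obtain ⟨x, hx⟩ : (S ∩ U i).Nonempty := by
      by_contra h
      rw [not_nonempty_iff_eq_empty] at h
      exact hu i (by rw [h]; exact Bornology.isBounded_empty)
    exact ⟨x, hx.1, (key i x hx).symm⟩

theorem encard_parts {n k : ℕ} {S V : Set (Fin n → ℝ)}
    {U : Fin k → Set (Fin n → ℝ)} (hU : ∀ i, IsOpen (U i)) (hV : IsOpen V)
    (hUU : ∀ i j, i < j → Disjoint (U i) (U j)) (hUV : ∀ i, Disjoint (U i) V)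
    (hS : S ⊆ (⋃ i, U i) ∪ V) (hb : Bornology.IsBounded (S ∩ V))
    (hc : ∀ i, IsPreconnected (S ∩ U i)) (hu : ∀ i, ¬ Bornology.IsBounded (S ∩ U i)) :
    (unboundedParts S).encard = k ∧
      (strictParts S).encard = {i | IsStrictlyConvex (S ∩ U i)}.encard := by
  have hUU' : ∀ i j, i ≠ j → Disjoint (U i) (U j) := fun i j hij =>
    (lt_or_gt_of_ne hij).elim (hUU i j) fun h => (hUU j i h).symm
  have hr := unboundedParts_eq_range hU hV hUU' hUV hS hb hc hu
  have hinj : Function.Injective fun i => S ∩ U i := by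
    intro i j hij
    by_contra hne
    have h0 : S ∩ U i = ∅ := by
      rw [← inter_self (S ∩ U i)]
      nth_rw 2 [show S ∩ U i = S ∩ U j from hij]
      exact ((hUU' i j hne).mono inter_subset_right inter_subset_right).inter_eq
    exact hu i (by rw [h0]; exact Bornology.isBounded_empty)
  constructor
  · rw [hr, ← image_univ, hinj.encard_image]
    simp
  · have : strictParts S = (fun i => S ∩ U i) '' {i | IsStrictlyConvex (S ∩ U i)} := by
      rw [strictParts, hr]
      ext C
      constructor
      · rintro ⟨⟨i, rfl⟩, h⟩
        exact ⟨i, h, rfl⟩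
      · rintro ⟨i, h, rfl⟩
        exact ⟨⟨i, rfl⟩, h⟩
    rw [this, hinj.encard_image]

theorem not_isBounded_of_coord {n : ℕ} {S : Set (Fin n → ℝ)} (j : Fin n)
    (h : ∀ r : ℝ, 0 < r → ∃ y ∈ S, r ≤ |y j|) : ¬ Bornology.IsBounded S := by
  intro hb
  obtain ⟨C, hC⟩ := hb.exists_norm_le
  obtain ⟨y, hy, hr⟩ := h (|C| + 1) (by positivity)
  have h1 := norm_le_pi_norm y j
  have h2 := hC y hy
  rw [Real.norm_eq_abs] at h1
  have := le_abs_self C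
  linarith

/-! ### Invariance under real affine equivalences -/

section Transfer

variable {n : ℕ} (e : (Fin n → ℝ) ≃ᵃ[ℝ] (Fin n → ℝ))

theorem isBounded_affine_image {C : Set (Fin n → ℝ)} (h : Bornology.IsBounded C) :
    Bornology.IsBounded (e '' C) := by
  have hc : IsCompact (e.toContinuousAffineEquiv.toHomeomorph '' closure C) :=
    h.isCompact_closure.image e.toContinuousAffineEquiv.toHomeomorph.continuous
  exact hc.isBounded.subset (image_mono subset_closure)

theorem isBounded_affine_image_iff {C : Set (Fin n → ℝ)} :
    Bornology.IsBounded (e '' C) ↔ Bornology.IsBounded C := by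
  refine ⟨fun h => ?_, isBounded_affine_image e⟩
  have := isBounded_affine_image e.symm h
  rwa [← image_comp, show (e.symm ∘ e : _ → _) = id from funext e.symm_apply_apply, image_id]
    at this

theorem IsStrictlyConvex.affine_image {C : Set (Fin n → ℝ)} (h : IsStrictlyConvex C) :
    IsStrictlyConvex (e '' C) := by
  intro x hx y hy hxy
  have hcl : e '' closure C = closure (e '' C) :=
    e.toContinuousAffineEquiv.toHomeomorph.image_closure C
  have hin : e '' interior C = interior (e '' C) :=
    e.toContinuousAffineEquiv.toHomeomorph.image_interior C
  rw [← hcl] at hx hy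
  obtain ⟨a, ha, rfl⟩ := hx
  obtain ⟨b, hb, rfl⟩ := hy
  rw [← hin]
  have := image_openSegment ℝ (e : (Fin n → ℝ) →ᵃ[ℝ] (Fin n → ℝ)) a b
  simp only [AffineEquiv.coe_coe] at this
  rw [← this]
  exact image_mono (h a ha b hb (by rintro rfl; exact hxy rfl))

theorem isStrictlyConvex_affine_image_iff {C : Set (Fin n → ℝ)} :
    IsStrictlyConvex (e '' C) ↔ IsStrictlyConvex C := by
  refine ⟨fun h => ?_, fun h => h.affine_image e⟩
  have := h.affine_image e.symm
  rwa [← image_comp, show (e.symm ∘ e : _ → _) = id from funext e.symm_apply_apply, image_id]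
    at this

theorem components_affine_image (S : Set (Fin n → ℝ)) :
    components (e '' S) = image e '' components S := by
  have h : ∀ x ∈ S, e '' connectedComponentIn S x = connectedComponentIn (e '' S) (e x) :=
    fun x hx => e.toContinuousAffineEquiv.toHomeomorph.image_connectedComponentIn hx
  ext C
  constructor
  · rintro ⟨_, ⟨x, hx, rfl⟩, rfl⟩
    exact ⟨_, ⟨x, hx, rfl⟩, h x hx⟩
  · rintro ⟨_, ⟨x, hx, rfl⟩, rfl⟩
    exact ⟨e x, mem_image_of_mem _ hx, h x hx⟩

theorem unboundedParts_affine_image (S : Set (Fin n → ℝ)) :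
    unboundedParts (e '' S) = image e '' unboundedParts S := by
  rw [unboundedParts, components_affine_image]
  ext C
  constructor
  · rintro ⟨⟨D, hD, rfl⟩, h⟩
    exact ⟨D, ⟨hD, fun h' => h ((isBounded_affine_image_iff e).2 h')⟩, rfl⟩
  · rintro ⟨D, hD, rfl⟩
    exact ⟨⟨D, hD.1, rfl⟩, fun h' => hD.2 ((isBounded_affine_image_iff e).1 h')⟩

theorem strictParts_affine_image (S : Set (Fin n → ℝ)) :
    strictParts (e '' S) = image e '' strictParts S := by
  rw [strictParts, unboundedParts_affine_image]
  ext C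
  constructor
  · rintro ⟨⟨D, hD, rfl⟩, h⟩
    exact ⟨D, ⟨hD, (isStrictlyConvex_affine_image_iff e).1 h⟩, rfl⟩
  · rintro ⟨D, hD, rfl⟩
    exact ⟨⟨D, hD.1, rfl⟩, (isStrictlyConvex_affine_image_iff e).2 hD.2⟩

theorem encard_unboundedParts_preimage (S : Set (Fin n → ℝ)) :
    (unboundedParts (e ⁻¹' S)).encard = (unboundedParts S).encard := by
  rw [← e.image_symm, unboundedParts_affine_image,
    (e.symm.injective.image_injective).encard_image]

theorem encard_strictParts_preimage (S : Set (Fin n → ℝ)) :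
    (strictParts (e ⁻¹' S)).encard = (strictParts S).encard := by
  rw [← e.image_symm, strictParts_affine_image,
    (e.symm.injective.image_injective).encard_image]

end Transfer

/-! ### Strict convexity and regions beyond hyperbola branches -/

/-- A supporting hyperplane touches the closure in two points. Their midpoint lies on it too, but it
cannot be interior, since a nonzero functional is an open map and would take values below `c`
nearby. -/
theorem not_isStrictlyConvex_of_coord_nonneg {n : ℕ} {C : Set (Fin n → ℝ)}
    (f : (Fin n → ℝ) →ₗ[ℝ] ℝ) (c : ℝ) (hf : f ≠ 0) (hC : ∀ y ∈ C, c ≤ f y) {x y : Fin n → ℝ}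
    (hx : x ∈ closure C) (hy : y ∈ closure C) (hxy : x ≠ y) (hfx : f x = c) (hfy : f y = c) :
    ¬ IsStrictlyConvex C := by
  intro h
  have hm : (1 / 2 : ℝ) • x + (1 / 2 : ℝ) • y ∈ openSegment ℝ x y :=
    ⟨1 / 2, 1 / 2, by norm_num, by norm_num, by norm_num, rfl⟩
  have hi := h x hx y hy hxy hm
  have hsurj : Function.Surjective f := LinearMap.surjective hf
  have hop : IsOpenMap f := f.isOpenMap_of_finiteDimensional hsurj
  have hmem : f ((1 / 2 : ℝ) • x + (1 / 2 : ℝ) • y) ∈ interior (Ici c) :=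
    interior_maximal (image_subset_iff.2 fun z hz => hC z (interior_subset hz))
      (hop _ isOpen_interior) (mem_image_of_mem f hi)
  rw [interior_Ici, map_add, map_smul, map_smul, hfx, hfy, mem_Ioi] at hmem
  simp only [smul_eq_mul] at hmem
  linarith

/-- The set of imaginary parts of the zeros of a function of two complex variables. -/
def imaginaryShadow (Q : ℂ → ℂ → ℂ) : Set (Fin 2 → ℝ) :=
  {y | ∃ z w : ℂ, Q z w = 0 ∧ z.im = y 0 ∧ w.im = y 1}

/-- The part of the quadrant with signs `σ`, `τ` beyond the hyperbola branch `|y₀ y₁| = h`. -/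
def hyperbolicRegion (σ τ h : ℝ) : Set (Fin 2 → ℝ) :=
  {y | 0 < σ * y 0 ∧ 0 < τ * y 1 ∧ h < (σ * y 0) * (τ * y 1)}

theorem isOpen_hyperbolicRegion (σ τ h : ℝ) : IsOpen (hyperbolicRegion σ τ h) := by
  have h0 : Continuous fun y : Fin 2 → ℝ => σ * y 0 := by fun_prop
  have h1 : Continuous fun y : Fin 2 → ℝ => τ * y 1 := by fun_prop
  exact (isOpen_lt continuous_const h0).inter
    ((isOpen_lt continuous_const h1).inter (isOpen_lt continuous_const (h0.mul h1)))

/-- Strict quasiconcavity of the product. If the differences `a - c` and `b - d` have opposite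
signs, the cross term in `hid` is a strict gain. Otherwise one point dominates the other
coordinatewise, and moving from the smaller point towards the larger strictly increases the product.
-/
theorem lt_mul_of_convex_comb {h a b c d s t : ℝ} (hh : 0 < h) (ha : 0 ≤ a) (hb : 0 ≤ b)
    (hc : 0 ≤ c) (hd : 0 ≤ d) (hab : h ≤ a * b) (hcd : h ≤ c * d) (hne : ¬ (a = c ∧ b = d))
    (hs : 0 < s) (ht : 0 < t) (hst : s + t = 1) : h < (s * a + t * c) * (s * b + t * d) := by
  have hid : (s * a + t * c) * (s * b + t * d) =
      s * (a * b) + t * (c * d) - s * t * ((a - c) * (b - d)) := by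
    have : t = 1 - s := by linarith
    subst this; ring
  have hst' : 0 < s * t := mul_pos hs ht
  have h1 : h ≤ s * (a * b) + t * (c * d) := by
    have := mul_le_mul_of_nonneg_left hab hs.le
    have := mul_le_mul_of_nonneg_left hcd ht.le
    nlinarith
  have ha' : 0 < a := lt_of_le_of_ne ha (by rintro rfl; linarith)
  have hb' : 0 < b := lt_of_le_of_ne hb (by rintro rfl; linarith)
  have hc' : 0 < c := lt_of_le_of_ne hc (by rintro rfl; linarith)
  have hd' : 0 < d := lt_of_le_of_ne hd (by rintro rfl; linarith)
  rcases lt_or_ge ((a - c) * (b - d)) 0 with hn | hn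
  · rw [hid]; nlinarith [mul_pos hst' (neg_pos.2 hn)]
  · have hcase : (c ≤ a ∧ d ≤ b) ∨ (a ≤ c ∧ b ≤ d) := by
      rcases lt_trichotomy a c with h' | h' | h'
      · right; refine ⟨h'.le, ?_⟩; by_contra hlt; push Not at hlt; nlinarith
      · subst h'; rcases le_total b d with h'' | h''
        · exact Or.inr ⟨le_rfl, h''⟩
        · exact Or.inl ⟨le_rfl, h''⟩
      · left; refine ⟨h'.le, ?_⟩; by_contra hlt; push Not at hlt; nlinarith
    have aux : ∀ a b c d s t : ℝ, 0 < c → 0 < d → h ≤ c * d → c ≤ a → d ≤ b →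
        ¬ (a = c ∧ b = d) → 0 < s → 0 < t → s + t = 1 →
        h < (s * a + t * c) * (s * b + t * d) := by
      intro a b c d s t hc hd hcd hca hdb hne hs ht hst
      have e1 : s * a + t * c = c + s * (a - c) := by
        have : t = 1 - s := by linarith
        subst this; ring
      have e2 : s * b + t * d = d + s * (b - d) := by
        have : t = 1 - s := by linarith
        subst this; ring
      rw [e1, e2]
      have p1 : 0 ≤ s * (a - c) := mul_nonneg hs.le (by linarith)
      have p2 : 0 ≤ s * (b - d) := mul_nonneg hs.le (by linarith)
      rcases hca.lt_or_eq with h1 | h1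
      · have : 0 < s * (a - c) := mul_pos hs (by linarith)
        nlinarith [mul_pos this hd, mul_nonneg p1 p2, mul_nonneg hc.le p2]
      · have h2 : d < b := lt_of_le_of_ne hdb fun h2 => hne ⟨h1.symm, h2.symm⟩
        have : 0 < s * (b - d) := mul_pos hs (by linarith)
        nlinarith [mul_pos this hc, mul_nonneg p1 p2, mul_nonneg p1 hd.le]
    rcases hcase with ⟨h2, h3⟩ | ⟨h2, h3⟩
    · exact aux a b c d s t hc' hd' hcd h2 h3 hne hs ht hst
    · have := aux c d a b t s ha' hb' hab h2 h3 (fun h => hne ⟨h.1.symm, h.2.symm⟩) ht hs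
        (by linarith)
      linarith

theorem convex_hyperbolicRegion (σ τ h : ℝ) :
    Convex ℝ (hyperbolicRegion σ τ h) := by
  rw [convex_iff_openSegment_subset]
  rintro x ⟨hx0, hx1, hx⟩ y ⟨hy0, hy1, hy⟩ _ ⟨s, t, hs, ht, hst, rfl⟩
  simp only [hyperbolicRegion, mem_ofPred_eq, Pi.add_apply, Pi.smul_apply, smul_eq_mul]
  have e0 : σ * (s * x 0 + t * y 0) = s * (σ * x 0) + t * (σ * y 0) := by ring
  have e1 : τ * (s * x 1 + t * y 1) = s * (τ * x 1) + t * (τ * y 1) := by ring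
  rw [e0, e1]
  refine ⟨by positivity, by positivity, ?_⟩
  by_cases heq : σ * x 0 = σ * y 0 ∧ τ * x 1 = τ * y 1
  · rw [heq.1, heq.2, ← add_mul, ← add_mul, hst, one_mul, one_mul]
    exact hy
  · exact lt_of_le_of_lt (le_min hx.le hy.le) (lt_mul_of_convex_comb
      (lt_min (by positivity) (by positivity)) hx0.le hx1.le hy0.le hy1.le
      (min_le_left _ _) (min_le_right _ _) heq hs ht hst)

theorem closure_hyperbolicRegion_subset (σ τ h : ℝ) : closure (hyperbolicRegion σ τ h) ⊆
    {y | 0 ≤ σ * y 0 ∧ 0 ≤ τ * y 1 ∧ h ≤ (σ * y 0) * (τ * y 1)} := by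
  refine closure_minimal (fun y hy => ⟨hy.1.le, hy.2.1.le, hy.2.2.le⟩) ?_
  have h0 : Continuous fun y : Fin 2 → ℝ => σ * y 0 := by fun_prop
  have h1 : Continuous fun y : Fin 2 → ℝ => τ * y 1 := by fun_prop
  exact (isClosed_le continuous_const h0).inter
    ((isClosed_le continuous_const h1).inter (isClosed_le continuous_const (h0.mul h1)))

theorem isStrictlyConvex_hyperbolicRegion {σ τ h : ℝ} (hσ : σ ≠ 0) (hτ : τ ≠ 0) (hh : 0 < h) :
    IsStrictlyConvex (hyperbolicRegion σ τ h) := by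
  intro x hx y hy hxy
  obtain ⟨hx0, hx1, hx⟩ := closure_hyperbolicRegion_subset σ τ h hx
  obtain ⟨hy0, hy1, hy⟩ := closure_hyperbolicRegion_subset σ τ h hy
  rw [(isOpen_hyperbolicRegion σ τ h).interior_eq]
  rintro _ ⟨s, t, hs, ht, hst, rfl⟩
  simp only [hyperbolicRegion, mem_ofPred_eq, Pi.add_apply, Pi.smul_apply, smul_eq_mul]
  have e0 : σ * (s * x 0 + t * y 0) = s * (σ * x 0) + t * (σ * y 0) := by ring
  have e1 : τ * (s * x 1 + t * y 1) = s * (τ * x 1) + t * (τ * y 1) := by ring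
  rw [e0, e1]
  have hlt := lt_mul_of_convex_comb hh hx0 hx1 hy0 hy1 hx hy (fun heq => hxy (by
    ext i
    fin_cases i
    · exact mul_left_cancel₀ hσ heq.1
    · exact mul_left_cancel₀ hτ heq.2)) hs ht hst
  have hpos := hh.trans hlt
  have n0 : 0 ≤ s * (σ * x 0) + t * (σ * y 0) := by positivity
  have n1 : 0 ≤ s * (τ * x 1) + t * (τ * y 1) := by positivity
  exact ⟨lt_of_le_of_ne n0 fun h0 => by rw [← h0] at hpos; simp at hpos,
    lt_of_le_of_ne n1 fun h0 => by rw [← h0] at hpos; simp at hpos, hlt⟩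

theorem not_isBounded_hyperbolicRegion {σ τ h : ℝ} (hσ : σ ≠ 0) (hτ : τ ≠ 0) (hh : 0 ≤ h) :
    ¬ Bornology.IsBounded (hyperbolicRegion σ τ h) := by
  refine not_isBounded_of_coord 0 fun r hr => ?_
  refine ⟨![σ⁻¹ * (|σ| * r + h + 1), τ⁻¹ * (|σ| * r + h + 1)], ?_, ?_⟩
  · have : 0 ≤ |σ| * r := by positivity
    simp only [hyperbolicRegion, mem_ofPred_eq, Matrix.cons_val_zero, Matrix.cons_val_one,
      mul_inv_cancel_left₀ hσ, mul_inv_cancel_left₀ hτ]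
    refine ⟨by positivity, by positivity, ?_⟩
    nlinarith
  · have hp : 0 < |σ| := abs_pos.2 hσ
    simp only [Matrix.cons_val_zero]
    rw [abs_mul, abs_inv, abs_of_pos (by positivity : 0 < |σ| * r + h + 1), inv_mul_eq_div,
      le_div_iff₀ hp]
    linarith

/-- For `h = 0` the hyperbola degenerates to the axes, so the region is an open quadrant with rays
in its boundary. -/
theorem not_isStrictlyConvex_hyperbolicRegion_zero {σ τ : ℝ} (hσ : σ ≠ 0) (hτ : τ ≠ 0) :
    ¬ IsStrictlyConvex (hyperbolicRegion σ τ 0) := by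
  have hcl : ∀ a : ℝ, 0 < a → ![σ⁻¹ * a, 0] ∈ closure (hyperbolicRegion σ τ 0) := by
    intro a ha
    have hcont : Continuous fun t : ℝ => (![σ⁻¹ * a, τ⁻¹ * t] : Fin 2 → ℝ) := by
      refine continuous_pi fun i => ?_
      fin_cases i
      · exact continuous_const
      · exact continuous_const.mul continuous_id
    have h0 : (0 : ℝ) ∈ closure (Ioi (0 : ℝ)) := by simp
    have := hcont.continuousWithinAt.mem_closure (s := Ioi (0 : ℝ)) (x := 0) h0
      (t := hyperbolicRegion σ τ 0) (fun t (ht : 0 < t) => by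
        simp only [hyperbolicRegion, mem_ofPred_eq, Matrix.cons_val_zero, Matrix.cons_val_one,
          mul_inv_cancel_left₀ hσ, mul_inv_cancel_left₀ hτ]
        exact ⟨ha, ht, mul_pos ha ht⟩)
    simpa using this
  refine not_isStrictlyConvex_of_coord_nonneg (τ • LinearMap.proj 1) 0 ?_
    (fun y hy => hy.2.1.le) (hcl 1 one_pos) (hcl 2 two_pos) ?_ (by simp) (by simp)
  · intro h
    have := LinearMap.congr_fun h ![0, 1]
    simp at this
    exact hτ this
  · intro h
    have := congrFun h 0
    simp only [Matrix.cons_val_zero] at this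
    have := mul_left_cancel₀ (inv_ne_zero hσ) this
    norm_num at this

/-! ### Imaginary projections of the normal forms -/

theorem mem_shadow_mul {c : ℂ} {y : Fin 2 → ℝ} :
    y ∈ imaginaryShadow (fun z w => z * w - c) ↔
      ∃ a b : ℝ, a * b - y 0 * y 1 = c.re ∧ a * y 1 + y 0 * b = c.im := by
  constructor
  · rintro ⟨z, w, h, h0, h1⟩
    have h' : z * w = c := sub_eq_zero.1 h
    refine ⟨z.re, w.re, ?_, ?_⟩
    · rw [← h', Complex.mul_re, h0, h1]
    · rw [← h', Complex.mul_im, h0, h1]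
  · rintro ⟨a, b, h0, h1⟩
    refine ⟨⟨a, y 0⟩, ⟨b, y 1⟩, ?_, rfl, rfl⟩
    apply Complex.ext <;> simp <;> linarith

theorem shadow_mul_zero_compl :
    (imaginaryShadow (fun z w => z * w - 0))ᶜ = {y | y 0 * y 1 ≠ 0} := by
  ext y
  rw [mem_compl_iff, mem_shadow_mul, mem_ofPred_eq, not_iff_not]
  simp only [Complex.zero_re, Complex.zero_im]
  constructor
  · rintro ⟨a, b, h0, h1⟩
    by_contra hne
    have hy0 : y 0 ≠ 0 := left_ne_zero_of_mul hne
    -- This eliminates `b` between the real and imaginary parts of `z * w = 0`.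
    have e : (a ^ 2 + y 0 ^ 2) * (y 0 * y 1) = 0 := by linear_combination y 0 * a * h1 - y 0 ^ 2 * h0
    rcases mul_eq_zero.1 e with h | h
    · have : 0 < y 0 ^ 2 := by positivity
      nlinarith [sq_nonneg a]
    · exact hne h
  · intro h
    exact ⟨0, 0, by linarith, by ring⟩

/-- Eliminating `b` gives `(a ^ 2 + y 0 ^ 2) * (y 0 * y 1) = -c * y 0 ^ 2`, which for `y 0 ≠ 0`
forces `-c ≤ y 0 * y 1 < 0`. On the axes only the origin is attained, by real zeros. -/
theorem shadow_mul_pos_compl {c : ℝ} (hc : 0 < c) :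
    (imaginaryShadow (fun z w => z * w - (c : ℂ)))ᶜ =
      {y | y 0 * y 1 < -c ∨ (0 ≤ y 0 * y 1 ∧ y ≠ 0)} := by
  ext y
  rw [mem_compl_iff, mem_shadow_mul, mem_ofPred_eq, ← not_iff_not, not_not]
  push Not
  simp only [Complex.ofReal_re, Complex.ofReal_im]
  constructor
  · rintro ⟨a, b, h0, h1⟩
    have e : (a ^ 2 + y 0 ^ 2) * (y 0 * y 1) = - c * y 0 ^ 2 := by
      linear_combination y 0 * a * h1 - y 0 ^ 2 * h0
    by_cases hy0 : y 0 = 0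
    · refine ⟨by rw [hy0]; linarith, fun _ => ?_⟩
      rw [hy0] at h0 h1
      have ha : a ≠ 0 := by rintro rfl; linarith
      ext i
      fin_cases i
      · exact hy0
      · have : a * y 1 = 0 := by linarith
        exact (mul_eq_zero.1 this).resolve_left ha
    · have hp : 0 < y 0 ^ 2 := by positivity
      refine ⟨?_, fun h => ?_⟩
      · by_contra hlt
        push Not at hlt
        nlinarith [sq_nonneg a]
      · nlinarith [sq_nonneg a, mul_pos hc hp, mul_nonneg (add_nonneg (sq_nonneg a) hp.le) h]
  · rintro ⟨h0, h1⟩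
    by_cases hm : 0 ≤ y 0 * y 1
    · have := h1 hm
      subst this
      exact ⟨1, c, by simp, by simp⟩
    · push Not at hm
      have hy0 : y 0 ≠ 0 := by intro h; rw [h] at hm; linarith
      have hy1 : y 1 ≠ 0 := by intro h; rw [h] at hm; linarith
      -- The quantity is the value of `a ^ 2` obtained by solving the eliminated equation.
      have hnn : 0 ≤ y 0 ^ 2 * ((c + y 0 * y 1) / (-(y 0 * y 1))) :=
        mul_nonneg (sq_nonneg _) (div_nonneg (by linarith) (by linarith))
      have ha := Real.sq_sqrt hnn
      set a := √(y 0 ^ 2 * ((c + y 0 * y 1) / (-(y 0 * y 1))))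
      refine ⟨a, - (a * y 1) / y 0, ?_, ?_⟩
      · have : a * (-(a * y 1) / y 0) = - (a ^ 2) * y 1 / y 0 := by ring
        rw [this, ha]
        field_simp
        ring
      · field_simp
        ring

/-- The numbers `a * y 1` and `y 0 * b` have sum `c.im` and product `y 0 * y 1 * (c.re + y 0 * y
1)`, so being real they force a nonnegative discriminant. The origin is exceptional, because a
product of two reals is never the nonreal `c`. -/
theorem shadow_mul_im_compl {c : ℂ} (hc : c.im ≠ 0) :
    (imaginaryShadow (fun z w => z * w - c))ᶜ =
      {y | c.im ^ 2 < 4 * (y 0 * y 1) ^ 2 + 4 * c.re * (y 0 * y 1) ∨ y = 0} := by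
  ext y
  rw [mem_compl_iff, mem_shadow_mul, mem_ofPred_eq, ← not_iff_not, not_not]
  push Not
  constructor
  · rintro ⟨a, b, h0, h1⟩
    refine ⟨?_, ?_⟩
    · rw [← h0, ← h1]
      nlinarith [sq_nonneg (a * y 1 - y 0 * b)]
    · rintro rfl
      simp at h1
      exact hc h1.symm
  · rintro ⟨h0, hne⟩
    by_cases hy0 : y 0 = 0
    · have hy1 : y 1 ≠ 0 := by
        intro h; apply hne; ext i; fin_cases i
        · exact hy0
        · exact h
      refine ⟨c.im / y 1, c.re * y 1 / c.im, ?_, ?_⟩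
      · rw [hy0]; field_simp; ring
      · rw [hy0]; field_simp; ring
    · suffices h : ∃ a : ℝ, y 1 * (a * a) + (-c.im) * a + (y 0 ^ 2 * y 1 + c.re * y 0) = 0 by
        obtain ⟨a, ha⟩ := h
        refine ⟨a, (c.im - a * y 1) / y 0, ?_, ?_⟩
        · field_simp
          linear_combination -ha
        · field_simp
          ring
      by_cases hy1 : y 1 = 0
      · refine ⟨c.re * y 0 / c.im, ?_⟩
        rw [hy1]; field_simp; ring
      · refine exists_quadratic_eq_zero hy1 ⟨√(c.im ^ 2 - 4 * (y 0 * y 1) ^ 2 -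
          4 * c.re * (y 0 * y 1)), ?_⟩
        rw [Real.mul_self_sqrt (by linarith), discrim]
        ring

theorem shadow_sq_compl (r : ℂ) : (imaginaryShadow (fun z _ => z ^ 2 - r ^ 2))ᶜ =
    {y | y 0 ≠ r.im ∧ y 0 ≠ -r.im} := by
  ext y
  rw [mem_compl_iff, mem_ofPred_eq, ← not_or, not_iff_not]
  constructor
  · rintro ⟨z, w, h, h0, -⟩
    rcases sq_eq_sq_iff_eq_or_eq_neg.1 (sub_eq_zero.1 h) with rfl | rfl
    · exact Or.inl h0.symm
    · exact Or.inr (by simpa using h0.symm)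
  · rintro (h | h)
    · exact ⟨r, ⟨0, y 1⟩, by simp, h.symm, rfl⟩
    · exact ⟨-r, ⟨0, y 1⟩, by simp, by simp [h], rfl⟩

theorem mem_shadow_parabola {k : ℂ} {y : Fin 2 → ℝ} :
    y ∈ imaginaryShadow (fun z w => w - k * z ^ 2) ↔
      ∃ a : ℝ, y 1 = k.re * (2 * a * y 0) + k.im * (a ^ 2 - y 0 ^ 2) := by
  constructor
  · rintro ⟨z, w, h, h0, h1⟩
    refine ⟨z.re, ?_⟩
    rw [← h1, ← h0, sub_eq_zero.1 h]
    simp only [pow_two, Complex.mul_im, Complex.mul_re]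
    ring
  · rintro ⟨a, h⟩
    refine ⟨⟨a, y 0⟩, k * ⟨a, y 0⟩ ^ 2, by simp, rfl, ?_⟩
    rw [h]
    simp only [pow_two, Complex.mul_im, Complex.mul_re]
    ring

theorem shadow_parabola_re_compl {k : ℝ} (hk : k ≠ 0) :
    (imaginaryShadow (fun z w => w - (k : ℂ) * z ^ 2))ᶜ = {y | y 0 = 0 ∧ y 1 ≠ 0} := by
  ext y
  rw [mem_compl_iff, mem_shadow_parabola, mem_ofPred_eq, ← not_iff_not, not_not]
  push Not
  simp only [Complex.ofReal_re, Complex.ofReal_im]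
  constructor
  · rintro ⟨a, h⟩ h0
    rw [h, h0]; ring
  · intro h
    by_cases h0 : y 0 = 0
    · exact ⟨0, by rw [h h0, h0]; ring⟩
    · exact ⟨y 1 / (2 * k * y 0), by field_simp; ring⟩

/-- Completing the square in the real part `a` of `z` turns the left-hand expression into `(k.im * a
+ k.re * y 0) ^ 2`, and as `a` varies this takes every nonnegative value. -/
theorem shadow_parabola_im_compl {k : ℂ} (hk : k.im ≠ 0) :
    (imaginaryShadow (fun z w => w - k * z ^ 2))ᶜ =
      {y | k.im * y 1 + (k.re ^ 2 + k.im ^ 2) * y 0 ^ 2 < 0} := by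
  ext y
  rw [mem_compl_iff, mem_shadow_parabola, mem_ofPred_eq, ← not_iff_not, not_not, not_lt]
  constructor
  · rintro ⟨a, h⟩
    rw [h]
    nlinarith [sq_nonneg (k.im * a + k.re * y 0)]
  · intro h
    have hs := Real.sq_sqrt h
    set s := √(k.im * y 1 + (k.re ^ 2 + k.im ^ 2) * y 0 ^ 2)
    refine ⟨(s - k.re * y 0) / k.im, ?_⟩
    have : y 1 = (s ^ 2 - (k.re ^ 2 + k.im ^ 2) * y 0 ^ 2) / k.im := by
      rw [hs]; field_simp; ring
    rw [this]
    field_simp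
    ring

/-! ### Counting components for `z * w = c` -/

theorem disjoint_hyperbolicRegion {σ τ h σ' τ' h' : ℝ} (hs : σ' = -σ ∨ τ' = -τ) :
    Disjoint (hyperbolicRegion σ τ h) (hyperbolicRegion σ' τ' h') := by
  rw [Set.disjoint_left]
  rintro y ⟨h0, h1, -⟩ ⟨h0', h1', -⟩
  rcases hs with rfl | rfl <;> linarith

/-- Common to `c = 0` and nonreal `c`. The threshold is `h` in the quadrants of equal signs and `k`
in the other two; `V` holds whatever bounded part lies between the branches. -/
theorem encard_parts_hyperbolicRegion {S V : Set (Fin 2 → ℝ)} {h k : ℝ} (hh : 0 ≤ h) (hk : 0 ≤ k)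
    (hV : IsOpen V) (hb : Bornology.IsBounded (S ∩ V))
    (hVm : ∀ y ∈ V, -k ≤ y 0 * y 1 ∧ y 0 * y 1 ≤ h)
    (hS : S ⊆ {y | h < y 0 * y 1 ∨ y 0 * y 1 < -k} ∪ V)
    (hS' : {y | h < y 0 * y 1 ∨ y 0 * y 1 < -k} ⊆ S) :
    (unboundedParts S).encard = 4 ∧ (strictParts S).encard = {i : Fin 4 | IsStrictlyConvex
      (![hyperbolicRegion 1 1 h, hyperbolicRegion (-1) (-1) h, hyperbolicRegion 1 (-1) k,
        hyperbolicRegion (-1) 1 k] i)}.encard := by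
  set U : Fin 4 → Set (Fin 2 → ℝ) := ![hyperbolicRegion 1 1 h, hyperbolicRegion (-1) (-1) h,
    hyperbolicRegion 1 (-1) k, hyperbolicRegion (-1) 1 k] with hU
  have hSU : ∀ i, S ∩ U i = U i := by
    intro i
    refine inter_eq_right.2 (Subset.trans ?_ hS')
    fin_cases i <;> rintro y ⟨h0, h1, h2⟩
    · left; linarith
    · left; linarith
    · right; linarith
    · right; linarith
  have key := encard_parts (S := S) (V := V) (U := U) (by
    intro i; fin_cases i <;> exact isOpen_hyperbolicRegion _ _ _) hV (by
    intro i j hij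
    fin_cases i <;> fin_cases j <;> first | exact absurd hij (by decide) |
      exact disjoint_hyperbolicRegion (by norm_num)) (by
    intro i
    rw [Set.disjoint_left]
    fin_cases i <;> rintro y ⟨h0, h1, h2⟩ hy <;> have := hVm y hy <;> linarith) (by
    intro y hy
    rcases hS hy with hm | hm
    · left
      rw [mem_iUnion]
      rcases hm with hm | hm
      · have hne : 0 < y 0 * y 1 := by linarith
        rcases pos_and_pos_or_neg_and_neg_of_mul_pos hne with ⟨h0, h1⟩ | ⟨h0, h1⟩
        · exact ⟨0, by linarith, by linarith, by linarith⟩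
        · exact ⟨1, by linarith, by linarith, by linarith⟩
      · have hne : y 0 * y 1 < 0 := by linarith
        rcases mul_neg_iff.1 hne with ⟨h0, h1⟩ | ⟨h0, h1⟩
        · exact ⟨2, by linarith, by linarith, by linarith⟩
        · exact ⟨3, by linarith, by linarith, by linarith⟩
    · exact Or.inr hm) hb (by
    intro i
    rw [hSU]
    fin_cases i <;> exact (convex_hyperbolicRegion _ _ _).isPreconnected) (by
    intro i
    rw [hSU]
    fin_cases i <;> exact not_isBounded_hyperbolicRegion (by norm_num) (by norm_num) (by assumption))
  simp only [hSU] at key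
  exact_mod_cast key

theorem encard_parts_shadow_mul_zero :
    (unboundedParts (imaginaryShadow (fun z w => z * w - 0))ᶜ).encard = 4 ∧
      (strictParts (imaginaryShadow (fun z w => z * w - 0))ᶜ).encard ≤ 2 := by
  rw [shadow_mul_zero_compl]
  have key := encard_parts_hyperbolicRegion (S := {y | y 0 * y 1 ≠ 0}) (V := ∅) le_rfl le_rfl
    isOpen_empty (by simp) (by simp) (fun y hy => Or.inl (by
      rcases lt_or_gt_of_ne hy with h | h
      · right; simpa using h
      · left; exact h)) (fun y hy => by
      rcases hy with h | h
      · exact h.ne'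
      · exact (by simpa using h : y 0 * y 1 < 0).ne)
  refine ⟨key.1, key.2.trans_le ?_⟩
  rw [show {i : Fin 4 | IsStrictlyConvex (_ : Set (Fin 2 → ℝ))} = ∅ from ?_]
  · simp
  · rw [eq_empty_iff_forall_notMem]
    intro i
    fin_cases i <;>
      exact not_isStrictlyConvex_hyperbolicRegion_zero (by norm_num) (by norm_num)

theorem encard_parts_shadow_mul_im {c : ℂ} (hc : c.im ≠ 0) :
    (unboundedParts (imaginaryShadow (fun z w => z * w - c))ᶜ).encard = 4 ∧
      (strictParts (imaginaryShadow (fun z w => z * w - c))ᶜ).encard = 4 := by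
  rw [shadow_mul_im_compl hc]
  have hci : 0 < c.im ^ 2 := by positivity
  have hn : 0 ≤ c.re ^ 2 + c.im ^ 2 := by positivity
  have hs := Real.sq_sqrt hn
  have hs0 := Real.sqrt_nonneg (c.re ^ 2 + c.im ^ 2)
  -- With `s = ‖c‖`, the roots in `m = y 0 * y 1` of the quadratic bounding the complement are `(s -
  -- c.re) / 2` and `-((s + c.re) / 2)`. They have opposite signs because `c` is nonreal.
  set s := √(c.re ^ 2 + c.im ^ 2)
  have hlt := abs_lt_of_sq_lt_sq (a := c.re) (b := s) (by linarith) hs0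
  rw [abs_lt] at hlt
  have hh : 0 < (s - c.re) / 2 := by linarith
  have hk : 0 < (s + c.re) / 2 := by linarith
  have hfac : ∀ m : ℝ, 4 * m ^ 2 + 4 * c.re * m - c.im ^ 2 =
      4 * ((m - (s - c.re) / 2) * (m - -((s + c.re) / 2))) := by
    intro m; linear_combination hs
  have hm : Continuous fun y : Fin 2 → ℝ => y 0 * y 1 := by fun_prop
  have key := encard_parts_hyperbolicRegion
    (S := {y | c.im ^ 2 < 4 * (y 0 * y 1) ^ 2 + 4 * c.re * (y 0 * y 1) ∨ y = 0})
    -- Between the branches the complement contains only the isolated point `0`, a bounded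
    -- component.
    (V := {y | -((s + c.re) / 2) < y 0 * y 1 ∧ y 0 * y 1 < (s - c.re) / 2}) hh.le hk.le
    ((isOpen_lt continuous_const hm).inter (isOpen_lt hm continuous_const)) (by
      refine (Bornology.isBounded_singleton (x := (0 : Fin 2 → ℝ))).subset ?_
      rintro y ⟨hy | hy, h1, h2⟩
      · exfalso
        have := hfac (y 0 * y 1)
        nlinarith
      · exact hy)
    (fun y hy => ⟨hy.1.le, hy.2.le⟩) (by
      rintro y (hy | rfl)
      · left
        by_contra hcon
        simp only [mem_ofPred_eq, not_or, not_lt] at hcon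
        have := hfac (y 0 * y 1)
        nlinarith
      · right
        refine ⟨?_, ?_⟩ <;> simp <;> linarith) (by
      rintro y hy
      left
      have := hfac (y 0 * y 1)
      rcases hy with hy | hy
      · have := mul_pos (sub_pos.2 hy) (by linarith : 0 < y 0 * y 1 - -((s + c.re) / 2))
        linarith
      · have := mul_pos_of_neg_of_neg (by linarith : y 0 * y 1 - (s - c.re) / 2 < 0)
          (sub_neg.2 hy)
        linarith)
  refine ⟨key.1, key.2.trans ?_⟩
  rw [show {i : Fin 4 | IsStrictlyConvex (_ : Set (Fin 2 → ℝ))} = univ from ?_]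
  · simp
  · rw [eq_univ_iff_forall]
    intro i
    fin_cases i <;>
      exact isStrictlyConvex_hyperbolicRegion (by norm_num) (by norm_num) (by assumption)

/-- The closed quadrant of sign `(σ, σ)` without the origin. -/
def puncturedQuadrant (σ : ℝ) : Set (Fin 2 → ℝ) :=
  {y | 0 ≤ σ * y 0 ∧ 0 ≤ σ * y 1 ∧ 0 < σ * (y 0 + y 1)}

theorem convex_puncturedQuadrant (σ : ℝ) : Convex ℝ (puncturedQuadrant σ) := by
  rw [convex_iff_openSegment_subset]
  rintro x ⟨hx0, hx1, hx⟩ y ⟨hy0, hy1, hy⟩ _ ⟨s, t, hs, ht, hst, rfl⟩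
  simp only [puncturedQuadrant, mem_ofPred_eq, Pi.add_apply, Pi.smul_apply, smul_eq_mul]
  have e0 : σ * (s * x 0 + t * y 0) = s * (σ * x 0) + t * (σ * y 0) := by ring
  have e1 : σ * (s * x 1 + t * y 1) = s * (σ * x 1) + t * (σ * y 1) := by ring
  have e2 : σ * (s * x 0 + t * y 0 + (s * x 1 + t * y 1)) =
    s * (σ * (x 0 + x 1)) + t * (σ * (y 0 + y 1)) := by ring
  rw [e0, e1, e2]
  exact ⟨by positivity, by positivity, by positivity⟩

theorem mem_puncturedQuadrant {σ a : ℝ} (hσ : σ ≠ 0) (ha : 0 < a) :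
    ![σ⁻¹ * a, 0] ∈ puncturedQuadrant σ := by
  simp [puncturedQuadrant, mul_inv_cancel_left₀ hσ, ha, ha.le]

theorem not_isBounded_puncturedQuadrant {σ : ℝ} (hσ : σ ≠ 0) :
    ¬ Bornology.IsBounded (puncturedQuadrant σ) := by
  refine not_isBounded_of_coord 0 fun r hr =>
    ⟨_, mem_puncturedQuadrant (a := |σ| * r) hσ (by positivity), ?_⟩
  simp only [Matrix.cons_val_zero]
  rw [abs_mul, abs_inv, abs_of_pos (by positivity : 0 < |σ| * r),
    inv_mul_cancel_left₀ (abs_ne_zero.2 hσ)]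

theorem not_isStrictlyConvex_puncturedQuadrant {σ : ℝ} (hσ : σ ≠ 0) :
    ¬ IsStrictlyConvex (puncturedQuadrant σ) := by
  refine not_isStrictlyConvex_of_coord_nonneg (σ • LinearMap.proj 1) 0 ?_
    (fun y hy => hy.2.1) (subset_closure (mem_puncturedQuadrant hσ one_pos))
    (subset_closure (mem_puncturedQuadrant hσ two_pos)) ?_ (by simp) (by simp)
  · intro h
    have := LinearMap.congr_fun h ![0, 1]
    simp at this
    exact hσ this
  · intro h
    have := congrFun h 0
    simp only [Matrix.cons_val_zero] at this
    have := mul_left_cancel₀ (inv_ne_zero hσ) this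
    norm_num at this

theorem encard_parts_shadow_mul_pos {c : ℝ} (hc : 0 < c) :
    (unboundedParts (imaginaryShadow (fun z w => z * w - (c : ℂ)))ᶜ).encard = 4 ∧
      (strictParts (imaginaryShadow (fun z w => z * w - (c : ℂ)))ᶜ).encard = 2 := by
  rw [shadow_mul_pos_compl hc]
  set S : Set (Fin 2 → ℝ) := {y | y 0 * y 1 < -c ∨ (0 ≤ y 0 * y 1 ∧ y ≠ 0)} with hS
  have hm : Continuous fun y : Fin 2 → ℝ => y 0 * y 1 := by fun_prop
  -- The punctured quadrants contain boundary points, so larger open sets must separate them. The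
  -- line `y 0 + y 1 = 0` does this, as it meets `0 ≤ y 0 * y 1` only at the excluded origin.
  set Q : ℝ → Set (Fin 2 → ℝ) := fun σ => {y | -c < y 0 * y 1 ∧ 0 < σ * (y 0 + y 1)} with hQ
  have hQo : ∀ σ, IsOpen (Q σ) := fun σ =>
    (isOpen_lt continuous_const hm).inter (isOpen_lt continuous_const
      (by fun_prop : Continuous fun y : Fin 2 → ℝ => σ * (y 0 + y 1)))
  have hSQ : ∀ σ : ℝ, σ = 1 ∨ σ = -1 → S ∩ Q σ = puncturedQuadrant σ := by
    intro σ hσ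
    have hσ2 : σ * σ = 1 := by rcases hσ with rfl | rfl <;> norm_num
    ext y
    have e : (σ * y 0) * (σ * y 1) = y 0 * y 1 := by linear_combination (y 0 * y 1) * hσ2
    constructor
    · rintro ⟨h1 | ⟨h1, -⟩, h2, h3⟩
      · linarith
      · rw [← e] at h1
        rw [mul_add] at h3
        have h0 : 0 ≤ σ * y 0 := by
          by_contra hneg
          push Not at hneg
          nlinarith
        refine ⟨h0, ?_, by rw [mul_add]; exact h3⟩
        by_contra hneg
        push Not at hneg
        nlinarith
    · rintro ⟨h0, h1, h2⟩
      have hnn : 0 ≤ y 0 * y 1 := e ▸ mul_nonneg h0 h1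
      refine ⟨Or.inr ⟨hnn, ?_⟩, by linarith, h2⟩
      rintro rfl
      simp at h2
  have hSH : ∀ σ : ℝ, σ = 1 ∨ σ = -1 →
      S ∩ hyperbolicRegion σ (-σ) c = hyperbolicRegion σ (-σ) c := by
    intro σ hσ
    have hσ2 : σ * σ = 1 := by rcases hσ with rfl | rfl <;> norm_num
    refine inter_eq_right.2 ?_
    rintro y ⟨-, -, h⟩
    left
    have e : (σ * y 0) * (-σ * y 1) = - (y 0 * y 1) := by linear_combination (- y 0 * y 1) * hσ2
    linarith
  have hHQ : ∀ σ τ : ℝ, σ = 1 ∨ σ = -1 → Disjoint (hyperbolicRegion σ (-σ) c) (Q τ) := by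
    intro σ τ hσ
    have hσ2 : σ * σ = 1 := by rcases hσ with rfl | rfl <;> norm_num
    rw [Set.disjoint_left]
    rintro y ⟨-, -, h⟩ ⟨h', -⟩
    have e : (σ * y 0) * (-σ * y 1) = - (y 0 * y 1) := by linear_combination (- y 0 * y 1) * hσ2
    linarith
  have p1 : (1 : ℝ) = 1 ∨ (1 : ℝ) = -1 := Or.inl rfl
  have m1 : (-1 : ℝ) = 1 ∨ (-1 : ℝ) = -1 := Or.inr rfl
  set U : Fin 4 → Set (Fin 2 → ℝ) := ![hyperbolicRegion 1 (-1) c, hyperbolicRegion (-1) (- -1) c,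
    Q 1, Q (-1)] with hU
  have hSU : ∀ i, S ∩ U i = ![hyperbolicRegion 1 (-1) c, hyperbolicRegion (-1) (- -1) c,
      puncturedQuadrant 1, puncturedQuadrant (-1)] i := by
    intro i
    fin_cases i
    · exact hSH 1 p1
    · exact hSH (-1) m1
    · exact hSQ 1 p1
    · exact hSQ (-1) m1
  have key := encard_parts (S := S) (V := ∅) (U := U) (by
    intro i
    fin_cases i
    · exact isOpen_hyperbolicRegion _ _ _
    · exact isOpen_hyperbolicRegion _ _ _
    · exact hQo _
    · exact hQo _) isOpen_empty (by
    intro i j hij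
    fin_cases i <;> fin_cases j <;> first | exact absurd hij (by decide) | skip
    · exact disjoint_hyperbolicRegion (by norm_num)
    · exact hHQ _ _ p1
    · exact hHQ _ _ p1
    · exact hHQ _ _ m1
    · exact hHQ _ _ m1
    · rw [Set.disjoint_left]
      rintro y ⟨-, h⟩ ⟨-, h'⟩
      linarith) (by simp) (by
    rintro y hy
    left
    rw [mem_iUnion]
    rcases hy with h | ⟨h, h'⟩
    · have hne : y 0 * y 1 < 0 := by linarith
      rcases mul_neg_iff.1 hne with ⟨h0, h1⟩ | ⟨h0, h1⟩
      · exact ⟨0, by linarith, by linarith, by linarith⟩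
      · exact ⟨1, by linarith, by linarith, by linarith⟩
    · rcases lt_trichotomy (y 0 + y 1) 0 with hl | hl | hl
      · exact ⟨3, by linarith, by linarith⟩
      · exfalso
        apply h'
        have h1 : y 1 = - y 0 := by linarith
        rw [h1] at h
        have h0 : y 0 = 0 := by nlinarith
        ext i
        fin_cases i
        · exact h0
        · simp [h1, h0]
      · exact ⟨2, by linarith, by linarith⟩) (by simp) (by
    intro i
    rw [hSU]
    fin_cases i
    · exact (convex_hyperbolicRegion _ _ _).isPreconnected
    · exact (convex_hyperbolicRegion _ _ _).isPreconnected
    · exact (convex_puncturedQuadrant _).isPreconnected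
    · exact (convex_puncturedQuadrant _).isPreconnected) (by
    intro i
    rw [hSU]
    fin_cases i
    · exact not_isBounded_hyperbolicRegion (by norm_num) (by norm_num) hc.le
    · exact not_isBounded_hyperbolicRegion (by norm_num) (by norm_num) hc.le
    · exact not_isBounded_puncturedQuadrant (by norm_num)
    · exact not_isBounded_puncturedQuadrant (by norm_num))
  refine ⟨by exact_mod_cast key.1, key.2.trans ?_⟩
  simp only [hSU]
  rw [show {i : Fin 4 | IsStrictlyConvex (_ : Set (Fin 2 → ℝ))} = {0, 1} from ?_]
  · rw [encard_pair (by decide)]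
  · ext i
    fin_cases i
    · simpa using isStrictlyConvex_hyperbolicRegion (by norm_num) (by norm_num) hc
    · simpa using isStrictlyConvex_hyperbolicRegion (by norm_num) (by norm_num) hc
    · simpa using not_isStrictlyConvex_puncturedQuadrant (by norm_num)
    · simpa using not_isStrictlyConvex_puncturedQuadrant (by norm_num)

/-! ### Counting components for `z ^ 2 = c` and `w = k * z ^ 2` -/

/-- The open vertical strip over an open interval of first coordinates. -/
def strip (I : Set ℝ) : Set (Fin 2 → ℝ) := {y | y 0 ∈ I}

theorem isOpen_strip {I : Set ℝ} (hI : IsOpen I) : IsOpen (strip I) :=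
  hI.preimage (continuous_apply 0)

theorem isPreconnected_strip {I : Set ℝ} (hI : Convex ℝ I) : IsPreconnected (strip I) :=
  (hI.linear_preimage (LinearMap.proj (R := ℝ) (φ := fun _ : Fin 2 => ℝ) 0)).isPreconnected

theorem not_isBounded_strip {I : Set ℝ} (hI : I.Nonempty) : ¬ Bornology.IsBounded (strip I) := by
  obtain ⟨a, ha⟩ := hI
  refine not_isBounded_of_coord 1 fun r hr => ⟨![a, r], ha, ?_⟩
  simp [le_abs_self]

theorem disjoint_strip {I J : Set ℝ} (h : Disjoint I J) : Disjoint (strip I) (strip J) :=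
  h.preimage _

theorem not_isStrictlyConvex_strip_Ioi (b : ℝ) : ¬ IsStrictlyConvex (strip (Ioi b)) := by
  have hcl : ∀ a : ℝ, ![b, a] ∈ closure (strip (Ioi b)) := by
    intro a
    have hcont : Continuous fun t : ℝ => (![t, a] : Fin 2 → ℝ) := by
      refine continuous_pi fun i => ?_
      fin_cases i
      · exact continuous_id
      · exact continuous_const
    have h0 : b ∈ closure (Ioi b) := by simp
    exact hcont.continuousWithinAt.mem_closure h0 fun t ht => ht
  refine not_isStrictlyConvex_of_coord_nonneg (LinearMap.proj 0) b ?_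
    (fun y hy => le_of_lt hy) (hcl 0) (hcl 1) ?_ (by simp) (by simp)
  · intro h
    have := LinearMap.congr_fun h ![1, 0]
    simp at this
  · intro h
    have := congrFun h 1
    simp at this

theorem encard_parts_shadow_sq_real {r : ℂ} (hr : r.im = 0) :
    (unboundedParts (imaginaryShadow (fun z _ => z ^ 2 - r ^ 2))ᶜ).encard = 2 := by
  rw [shadow_sq_compl, hr]
  set S : Set (Fin 2 → ℝ) := {y | y 0 ≠ 0 ∧ y 0 ≠ -0} with hS
  set U : Fin 2 → Set (Fin 2 → ℝ) := ![strip (Ioi 0), strip (Iio 0)] with hU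
  have hSU : ∀ i, S ∩ U i = U i := by
    intro i
    refine inter_eq_right.2 fun y hy => ?_
    fin_cases i
    · exact ⟨(show 0 < y 0 from hy).ne', by simpa using (show 0 < y 0 from hy).ne'⟩
    · exact ⟨(show y 0 < 0 from hy).ne, by simpa using (show y 0 < 0 from hy).ne⟩
  have key := encard_parts (S := S) (V := ∅) (U := U) (by
    intro i
    fin_cases i
    · exact isOpen_strip isOpen_Ioi
    · exact isOpen_strip isOpen_Iio) isOpen_empty (by
    intro i j hij
    fin_cases i <;> fin_cases j <;> first | exact absurd hij (by decide) | skip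
    exact disjoint_strip (Set.disjoint_left.2 fun x (h1 : 0 < x) (h2 : x < 0) => lt_asymm h1 h2)) (by simp) (by
    intro y hy
    left
    rw [mem_iUnion]
    rcases lt_or_gt_of_ne hy.1 with h | h
    · exact ⟨1, h⟩
    · exact ⟨0, h⟩) (by simp) (by
    intro i
    rw [hSU]
    fin_cases i
    · exact isPreconnected_strip (convex_Ioi _)
    · exact isPreconnected_strip (convex_Iio _)) (by
    intro i
    rw [hSU]
    fin_cases i
    · exact not_isBounded_strip nonempty_Ioi
    · exact not_isBounded_strip nonempty_Iio)
  exact_mod_cast key.1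

theorem encard_parts_shadow_sq_nonreal {r : ℂ} (hr : r.im ≠ 0) :
    (unboundedParts (imaginaryShadow (fun z _ => z ^ 2 - r ^ 2))ᶜ).encard = 3 ∧
      (strictParts (imaginaryShadow (fun z _ => z ^ 2 - r ^ 2))ᶜ).encard ≤ 2 := by
  have hb : 0 < |r.im| := abs_pos.2 hr
  have hS : (imaginaryShadow (fun z _ => z ^ 2 - r ^ 2))ᶜ =
      {y | y 0 ≠ |r.im| ∧ y 0 ≠ -|r.im|} := by
    rw [shadow_sq_compl]
    rcases abs_choice r.im with h | h
    · rw [h]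
    · rw [h, neg_neg]
      ext y
      exact and_comm
  rw [hS]
  set b := |r.im|
  set S : Set (Fin 2 → ℝ) := {y | y 0 ≠ b ∧ y 0 ≠ -b}
  set U : Fin 3 → Set (Fin 2 → ℝ) :=
    ![strip (Ioi b), strip (Ioo (-b) b), strip (Iio (-b))] with hU
  have hSU : ∀ i, S ∩ U i = U i := by
    intro i
    refine inter_eq_right.2 fun y hy => ?_
    fin_cases i
    · have h : b < y 0 := hy
      exact ⟨h.ne', (by linarith : -b < y 0).ne'⟩
    · exact ⟨hy.2.ne, hy.1.ne'⟩
    · have h : y 0 < -b := hy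
      exact ⟨(by linarith : y 0 < b).ne, h.ne⟩
  have key := encard_parts (S := S) (V := ∅) (U := U) (by
    intro i
    fin_cases i
    · exact isOpen_strip isOpen_Ioi
    · exact isOpen_strip isOpen_Ioo
    · exact isOpen_strip isOpen_Iio) isOpen_empty (by
    intro i j hij
    fin_cases i <;> fin_cases j <;> first | exact absurd hij (by decide) | skip
    · exact disjoint_strip (Set.disjoint_left.2 fun x h1 h2 => lt_asymm h1 h2.2)
    · exact disjoint_strip (Set.disjoint_left.2 fun x (h1 : b < x) (h2 : x < -b) => by linarith)
    · exact disjoint_strip (Set.disjoint_left.2 fun x h1 h2 => lt_asymm h1.1 h2)) (by simp) (by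
    intro y hy
    left
    rw [mem_iUnion]
    rcases lt_or_gt_of_ne hy.1 with h | h
    · rcases lt_or_gt_of_ne hy.2 with h' | h'
      · exact ⟨2, h'⟩
      · exact ⟨1, h', h⟩
    · exact ⟨0, h⟩) (by simp) (by
    intro i
    rw [hSU]
    fin_cases i
    · exact isPreconnected_strip (convex_Ioi _)
    · exact isPreconnected_strip (convex_Ioo _ _)
    · exact isPreconnected_strip (convex_Iio _)) (by
    intro i
    rw [hSU]
    fin_cases i
    · exact not_isBounded_strip nonempty_Ioi
    · exact not_isBounded_strip (nonempty_Ioo.2 (by linarith))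
    · exact not_isBounded_strip nonempty_Iio)
  refine ⟨by exact_mod_cast key.1, key.2.trans_le ?_⟩
  -- Discarding one half-plane already gives the bound 2, so the other two pieces need no
  -- examination.
  rw [← encard_pair (show (1 : Fin 3) ≠ 2 by decide)]
  refine encard_le_encard ?_
  intro i hi
  rw [mem_ofPred_eq, hSU] at hi
  fin_cases i
  · exact absurd hi (not_isStrictlyConvex_strip_Ioi b)
  · simp
  · simp

theorem encard_parts_shadow_parabola_re {k : ℝ} (hk : k ≠ 0) :
    (unboundedParts (imaginaryShadow (fun z w => w - (k : ℂ) * z ^ 2))ᶜ).encard = 2 := by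
  rw [shadow_parabola_re_compl hk]
  set S : Set (Fin 2 → ℝ) := {y | y 0 = 0 ∧ y 1 ≠ 0}
  have hc : Continuous fun y : Fin 2 → ℝ => y 1 := by fun_prop
  set U : Fin 2 → Set (Fin 2 → ℝ) := ![{y | 0 < y 1}, {y | y 1 < 0}] with hU
  have hSU : ∀ i, S ∩ U i = ({y | y 0 = 0} : Set (Fin 2 → ℝ)) ∩ U i := by
    intro i
    ext y
    refine ⟨fun h => ⟨h.1.1, h.2⟩, fun h => ⟨⟨h.1, ?_⟩, h.2⟩⟩
    fin_cases i
    · exact (show 0 < y 1 from h.2).ne'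
    · exact (show y 1 < 0 from h.2).ne
  have hl : Convex ℝ ({y | y 0 = 0} : Set (Fin 2 → ℝ)) :=
    (convex_singleton (0 : ℝ)).linear_preimage
      (LinearMap.proj (R := ℝ) (φ := fun _ : Fin 2 => ℝ) 0)
  have key := encard_parts (S := S) (V := ∅) (U := U) (by
    intro i
    fin_cases i
    · exact isOpen_lt continuous_const hc
    · exact isOpen_lt hc continuous_const) isOpen_empty (by
    intro i j hij
    fin_cases i <;> fin_cases j <;> first | exact absurd hij (by decide) | skip
    exact Set.disjoint_left.2 fun y h h' => lt_asymm (show 0 < y 1 from h) h') (by simp) (by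
    intro y hy
    left
    rw [mem_iUnion]
    rcases lt_or_gt_of_ne hy.2 with h | h
    · exact ⟨1, h⟩
    · exact ⟨0, h⟩) (by simp) (by
    intro i
    rw [hSU]
    fin_cases i
    · exact (hl.inter ((convex_Ioi (0 : ℝ)).linear_preimage
        (LinearMap.proj (R := ℝ) (φ := fun _ : Fin 2 => ℝ) 1))).isPreconnected
    · exact (hl.inter ((convex_Iio (0 : ℝ)).linear_preimage
        (LinearMap.proj (R := ℝ) (φ := fun _ : Fin 2 => ℝ) 1))).isPreconnected) (by
    intro i
    rw [hSU]
    fin_cases i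
    · refine not_isBounded_of_coord 1 fun r hr => ⟨![0, r], ⟨rfl, hr⟩, ?_⟩
      simp [le_abs_self]
    · refine not_isBounded_of_coord 1 fun r hr => ⟨![0, -r], ⟨rfl, neg_lt_zero.2 hr⟩, ?_⟩
      simp [le_abs_self])
  exact_mod_cast key.1

theorem encard_parts_shadow_parabola_im {k : ℂ} (hk : k.im ≠ 0) :
    (unboundedParts (imaginaryShadow (fun z w => w - k * z ^ 2))ᶜ).encard = 1 := by
  rw [shadow_parabola_im_compl hk]
  set S : Set (Fin 2 → ℝ) := {y | k.im * y 1 + (k.re ^ 2 + k.im ^ 2) * y 0 ^ 2 < 0} with hS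
  have key := encard_parts (S := S) (V := ∅) (U := fun _ : Fin 1 => univ) (by simp) isOpen_empty (by
    intro i j hij
    exact absurd hij (by simp [Subsingleton.elim i j])) (by simp) (by
    intro y hy
    left
    simp) (by simp) (by
    intro i
    rw [inter_univ]
    refine Convex.isPreconnected ?_
    rw [convex_iff_openSegment_subset]
    rintro x hx y hy _ ⟨s, t, hs, ht, hst, rfl⟩
    simp only [hS, mem_ofPred_eq, Pi.add_apply, Pi.smul_apply, smul_eq_mul] at hx hy ⊢
    have hid : k.im * (s * x 1 + t * y 1) + (k.re ^ 2 + k.im ^ 2) * (s * x 0 + t * y 0) ^ 2 =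
        s * (k.im * x 1 + (k.re ^ 2 + k.im ^ 2) * x 0 ^ 2) +
        t * (k.im * y 1 + (k.re ^ 2 + k.im ^ 2) * y 0 ^ 2) -
        (k.re ^ 2 + k.im ^ 2) * (s * t * (x 0 - y 0) ^ 2) := by
      have : t = 1 - s := by linarith
      subst this; ring
    have h1 := mul_neg_of_pos_of_neg hs hx
    have h2 := mul_neg_of_pos_of_neg ht hy
    have h3 : 0 ≤ (k.re ^ 2 + k.im ^ 2) * (s * t * (x 0 - y 0) ^ 2) := by positivity
    linarith) (by
    intro i
    rw [inter_univ]
    -- The second coordinate is `-r` times the sign of `k.im`.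
    refine not_isBounded_of_coord 1 fun r hr => ⟨![0, - r / k.im * |k.im|], ?_, ?_⟩
    · simp only [hS, mem_ofPred_eq, Matrix.cons_val_zero, Matrix.cons_val_one]
      have : k.im * (-r / k.im * |k.im|) = -(r * |k.im|) := by field_simp
      rw [this]
      have : 0 < r * |k.im| := mul_pos hr (abs_pos.2 hk)
      linarith
    · rw [show (![0, - r / k.im * |k.im|] : Fin 2 → ℝ) 1 = - r / k.im * |k.im| from rfl, abs_mul, abs_div, abs_neg, abs_abs, div_mul_cancel₀ _ (abs_ne_zero.2 hk)]
      exact le_abs_self r)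
  exact_mod_cast key.1

/-! ### Bounded complement when a factor is not proportional to a real form -/

/-- Banach's fixed point theorem on the ball of radius `K + 1`. Smoothness is only real because `G`
will involve `conj`. -/
theorem exists_eq_add_div_of_lipschitz {G : ℂ → ℂ} (hG : ContDiff ℝ 1 G) (K : ℝ) :
    ∃ R > 0, ∀ k r : ℂ, ‖k‖ ≤ K → R ≤ ‖r‖ → ∃ u, u = k + G u / r := by
  set B := Metric.closedBall (0 : ℂ) (K + 1) with hB
  have hBc : IsCompact B := isCompact_closedBall _ _
  obtain ⟨L, hL⟩ := (hG.locallyLipschitz.locallyLipschitzOn (s := B)).exists_lipschitzOnWith_of_compact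
    hBc
  obtain ⟨M, hM⟩ := hBc.exists_bound_of_continuousOn hG.continuous.continuousOn
  -- The term `2 * L` makes the contraction constant `1 / 2`, `|M|` keeps the ball invariant, and
  -- `1` keeps `r` nonzero.
  refine ⟨2 * L + |M| + 1, by positivity, fun k r hk hr => ?_⟩
  have hr0 : 0 < ‖r‖ := lt_of_lt_of_le (by positivity) hr
  have hmaps : MapsTo (fun u => k + G u / r) B B := by
    intro u hu
    rw [hB, mem_closedBall_zero_iff]
    refine (norm_add_le _ _).trans (add_le_add hk ?_)
    rw [norm_div, div_le_one hr0]
    have h1 := hM u hu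
    have h2 := le_abs_self M
    have h3 : (0 : ℝ) ≤ L := L.2
    linarith
  have hcontr : ContractingWith (1 / 2) (hmaps.restrict _ B B) := by
    refine ⟨by norm_num, LipschitzWith.of_dist_le_mul fun x y => ?_⟩
    have h1 := hL.dist_le_mul x x.2 y y.2
    rw [Subtype.dist_eq, MapsTo.val_restrict_apply, MapsTo.val_restrict_apply, dist_add_left,
      dist_eq_norm, ← sub_div, norm_div, ← dist_eq_norm, div_le_iff₀ hr0]
    refine h1.trans ?_
    have h2 : (L : ℝ) ≤ 1 / 2 * ‖r‖ := by
      have := abs_nonneg M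
      linarith
    have := mul_le_mul_of_nonneg_right h2 (dist_nonneg (x := x) (y := y))
    rw [← Subtype.dist_eq]
    push_cast
    linarith
  have hk' : k ∈ B := by
    rw [hB, mem_closedBall_zero_iff]
    linarith
  obtain ⟨u, -, hu, -⟩ := hcontr.exists_fixedPoint' hBc.isComplete hmaps hk' (edist_ne_top _ _)
  exact ⟨u, hu.symm⟩

/-- For `u = z + I * w` and `v = z - I * w`, the difference `conj u - v` depends only on the
imaginary parts of `z` and `w`. Fixing those therefore leaves `u` as the single free complex
unknown. -/
theorem isBounded_shadow_compl {Q : ℂ → ℂ → ℂ} {R : ℝ}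
    (h : ∀ Y : ℂ, R ≤ ‖Y‖ → ∃ u, Q u (conj u - conj Y) = 0) :
    Bornology.IsBounded
      (imaginaryShadow fun z w => Q (z + Complex.I * w) (z - Complex.I * w))ᶜ := by
  refine (Metric.isBounded_closedBall (x := (0 : Fin 2 → ℝ)) (r := |R|)).subset ?_
  intro y hy
  rw [mem_closedBall_zero_iff]
  by_contra hlt
  apply hy
  push Not at hlt
  set Y : ℂ := ⟨-2 * y 1, 2 * y 0⟩ with hY
  obtain ⟨u, hu⟩ := h Y (by
    by_contra hYR
    push Not at hYR
    refine absurd hlt (not_lt.2 ((pi_norm_le_iff_of_nonneg (abs_nonneg R)).2 fun i => ?_))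
    have h1 := Complex.abs_re_le_norm Y
    have h2 := Complex.abs_im_le_norm Y
    rw [hY] at h1 h2
    simp only [abs_mul, abs_neg, abs_two] at h1 h2
    have h3 := le_abs_self R
    have h4 := abs_nonneg (y 0)
    have h5 := abs_nonneg (y 1)
    rw [Real.norm_eq_abs]
    fin_cases i
    · change |y 0| ≤ |R|
      linarith
    · change |y 1| ≤ |R|
      linarith)
  refine ⟨(u + (conj u - conj Y)) / 2, (u - (conj u - conj Y)) / (2 * Complex.I), ?_, ?_, ?_⟩
  · have e1 : (u + (conj u - conj Y)) / 2 +
        Complex.I * ((u - (conj u - conj Y)) / (2 * Complex.I)) = u := by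
      field_simp
      ring
    have e2 : (u + (conj u - conj Y)) / 2 -
        Complex.I * ((u - (conj u - conj Y)) / (2 * Complex.I)) = conj u - conj Y := by
      field_simp
      ring
    beta_reduce
    rw [e1, e2, hu]
  · simp [hY]
  · have e : (u - (conj u - conj Y)) / (2 * Complex.I) = ⟨u.im - y 0, y 1⟩ := by
      rw [div_eq_iff (by simp)]
      apply Complex.ext <;> simp [hY] <;> ring
    rw [e]

theorem isBounded_shadow_compl_of_mul (a d e f : ℂ) : Bornology.IsBounded
    (imaginaryShadow fun z w =>
      (fun u v => u * (a * u + v) + d * u + e * v + f)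
        (z + Complex.I * w) (z - Complex.I * w))ᶜ := by
  obtain ⟨R, hR, h⟩ := exists_eq_add_div_of_lipschitz
    (G := fun u => a * u ^ 2 + u * conj u + d * u + e * conj u + f) (by
      have : ContDiff ℝ 1 (fun u : ℂ => conj u) := Complex.conjCLE.contDiff
      fun_prop) ‖e‖
  refine isBounded_shadow_compl (Q := fun u v => u * (a * u + v) + d * u + e * v + f) (R := R) fun Y hY => ?_
  -- After substituting for `v`, the equation reads `(u + e) * conj Y = G u`.
  obtain ⟨u, hu⟩ := h (-e) (conj Y) (by simp) (by simpa using hY)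
  refine ⟨u, ?_⟩
  have hY0 : conj Y ≠ 0 := by
    rw [← norm_pos_iff]
    simpa using hR.trans_le hY
  field_simp at hu
  linear_combination -hu

theorem isBounded_shadow_compl_of_sq (d e f : ℂ) : Bornology.IsBounded
    (imaginaryShadow fun z w =>
      (fun u v => u ^ 2 + d * u + e * v + f)
        (z + Complex.I * w) (z - Complex.I * w))ᶜ := by
  by_cases he : e = 0
  · subst he
    obtain ⟨s, hs⟩ := IsAlgClosed.exists_pow_nat_eq (d ^ 2 - 4 * f) two_pos
    refine isBounded_shadow_compl (Q := fun u v => u ^ 2 + d * u + 0 * v + f) (R := 0) fun Y _ => ⟨(s - d) / 2, ?_⟩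
    linear_combination hs / 4
  · obtain ⟨R, hR, h⟩ := exists_eq_add_div_of_lipschitz
      (G := fun u => -(u ^ 2 + d * u + e * conj u) / 2) (by
        have : ContDiff ℝ 1 (fun u : ℂ => conj u) := Complex.conjCLE.contDiff
        fun_prop) ((‖d‖ + ‖e‖) / 2)
    have he0 : 0 < ‖e‖ := norm_pos_iff.2 he
    refine isBounded_shadow_compl (Q := fun u v => u ^ 2 + d * u + e * v + f) (R := (R ^ 2 + ‖f‖) / ‖e‖) fun Y hY => ?_
    -- The dominant balance is `u ^ 2 ≈ e * conj Y`. Writing the root as `r + u`, the correction `u`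
    -- stays bounded and solves a fixed point equation with small parameter `1 / r`.
    obtain ⟨r, hr⟩ := IsAlgClosed.exists_pow_nat_eq (e * conj Y - f) two_pos
    have hrR : R ≤ ‖r‖ := by
      refine le_of_sq_le_sq ?_ (norm_nonneg r)
      rw [← norm_pow, hr]
      rw [div_le_iff₀ he0] at hY
      have := norm_sub_norm_le (e * conj Y) f
      rw [norm_mul, RCLike.norm_conj] at this
      linarith
    have hr0 : r ≠ 0 := norm_pos_iff.1 (hR.trans_le hrR)
    obtain ⟨u, hu⟩ := h (-(d * r + e * conj r) / (2 * r)) r (by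
      rw [norm_div, norm_neg, div_le_iff₀ (norm_pos_iff.2 (mul_ne_zero two_ne_zero hr0)), norm_mul 2]
      have := norm_add_le (d * r) (e * conj r)
      rw [norm_mul, norm_mul, RCLike.norm_conj] at this
      rw [Complex.norm_ofNat]
      linarith) hrR
    refine ⟨r + u, ?_⟩
    field_simp at hu
    rw [map_add]
    linear_combination hu + hr

/-! ### Reduction of a general conic to the normal forms -/

theorem encard_parts_shadow_of_affine {P Q : ℂ → ℂ → ℂ} (m₁ m₂ n₁ n₂ : ℝ) (v w : ℂ)
    (hdet : m₁ * n₂ - m₂ * n₁ ≠ 0)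
    (h : ∀ x y : ℂ, P x y = 0 ↔ Q (m₁ * x + m₂ * y + v) (n₁ * x + n₂ * y + w) = 0) :
    (unboundedParts (imaginaryShadow P)ᶜ).encard = (unboundedParts (imaginaryShadow Q)ᶜ).encard ∧
      (strictParts (imaginaryShadow P)ᶜ).encard = (strictParts (imaginaryShadow Q)ᶜ).encard := by
  set D := m₁ * n₂ - m₂ * n₁ with hD
  let L : (Fin 2 → ℝ) ≃ₗ[ℝ] (Fin 2 → ℝ) :=
    { toFun := fun y => ![m₁ * y 0 + m₂ * y 1, n₁ * y 0 + n₂ * y 1]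
      invFun := fun y => ![(n₂ * y 0 - m₂ * y 1) / D, (m₁ * y 1 - n₁ * y 0) / D]
      map_add' := fun x y => by ext i; fin_cases i <;> simp <;> ring
      map_smul' := fun c y => by ext i; fin_cases i <;> simp <;> ring
      left_inv := fun y => by
        ext i
        fin_cases i <;> simp <;> rw [div_eq_iff hdet, hD] <;> ring
      right_inv := fun y => by
        ext i
        fin_cases i <;> simp <;> field_simp <;> rw [hD] <;> ring }
  let e : (Fin 2 → ℝ) ≃ᵃ[ℝ] (Fin 2 → ℝ) :=
    L.toAffineEquiv.trans (AffineEquiv.constVAdd ℝ (Fin 2 → ℝ) ![v.im, w.im])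
  have he0 : ∀ y, e y 0 = m₁ * y 0 + m₂ * y 1 + v.im := fun y => add_comm _ _
  have he1 : ∀ y, e y 1 = n₁ * y 0 + n₂ * y 1 + w.im := fun y => add_comm _ _
  have hδ : ((1 / D : ℝ) : ℂ) * (m₁ * n₂ - m₂ * n₁) = 1 := by
    have hDc : (m₁ * n₂ - m₂ * n₁ : ℂ) = (D : ℂ) := by rw [hD]; push_cast; rfl
    rw [hDc, ← Complex.ofReal_mul, one_div_mul_cancel hdet, Complex.ofReal_one]
  have key : (imaginaryShadow P)ᶜ = e ⁻¹' (imaginaryShadow Q)ᶜ := by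
    rw [preimage_compl]
    congr 1
    ext y
    constructor
    · rintro ⟨a, b, hab, ha, hb⟩
      refine ⟨_, _, (h a b).1 hab, ?_, ?_⟩
      · rw [he0]; simp [ha, hb]
      · rw [he1]; simp [ha, hb]
    · rintro ⟨a, b, hab, ha, hb⟩
      rw [he0] at ha
      rw [he1] at hb
      refine ⟨((1 / D : ℝ) : ℂ) * (n₂ * (a - v) - m₂ * (b - w)),
        ((1 / D : ℝ) : ℂ) * (m₁ * (b - w) - n₁ * (a - v)), (h _ _).2 ?_, ?_, ?_⟩
      · convert hab using 2
        · linear_combination (a - v) * hδ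
        · linear_combination (b - w) * hδ
      · simp only [Complex.im_ofReal_mul, Complex.sub_im, ha, hb]
        field_simp
        rw [hD]
        ring
      · simp only [Complex.im_ofReal_mul, Complex.sub_im, ha, hb]
        field_simp
        rw [hD]
        ring
  rw [key]
  exact ⟨encard_unboundedParts_preimage e _, encard_strictParts_preimage e _⟩

/-- A quadratic function of two complex variables in terms of its coefficients. -/
def quadratic (a b c d e f : ℂ) (z w : ℂ) : ℂ :=
  a * z ^ 2 + b * (z * w) + c * w ^ 2 + d * z + e * w + f

theorem exists_linear_factors (a b c : ℂ) : ∃ p q r s : ℂ,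
    a = p * r ∧ b = p * s + q * r ∧ c = q * s := by
  by_cases ha : a = 0
  · exact ⟨0, 1, b, c, by simp [ha], by simp, by simp⟩
  · obtain ⟨t, ht⟩ := IsAlgClosed.exists_pow_nat_eq (b ^ 2 - 4 * a * c) two_pos
    refine ⟨a, (b + t) / 2, 1, (b - t) / (2 * a), by simp, ?_, ?_⟩
    · field_simp
      ring
    · field_simp
      linear_combination ht

/-- The vanishing determinant says that `q / p` is real when `p ≠ 0`. -/
theorem exists_real_multiple {p q : ℂ} (h : p.re * q.im - q.re * p.im = 0)
    (hne : ¬ (p = 0 ∧ q = 0)) :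
    ∃ (k : ℂ) (r s : ℝ), k ≠ 0 ∧ p = k * r ∧ q = k * s ∧ 0 < r ^ 2 + s ^ 2 := by
  by_cases hp : p = 0
  · refine ⟨q, 0, 1, fun hq => hne ⟨hp, hq⟩, by simp [hp], by simp, by norm_num⟩
  · refine ⟨p, 1, (q / p).re, hp, by simp, ?_, by positivity⟩
    have him : (q / p).im = 0 := by
      rw [Complex.div_im, ← sub_div]
      rw [show q.im * p.re - q.re * p.im = 0 by linarith, zero_div]
    have : ((q / p).re : ℂ) = q / p := Complex.ext (by simp) (by simp [him])
    rw [this, mul_div_cancel₀ _ hp]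

theorem encard_parts_of_nonreal_factor {p q r s d e f : ℂ}
    (h : p.re * q.im - q.re * p.im ≠ 0) (hne : ¬ (r = 0 ∧ s = 0)) :
    (unboundedParts (imaginaryShadow
      (quadratic (p * r) (p * s + q * r) (q * s) d e f))ᶜ).encard = 0 := by
  set D : ℂ := ((p.re * q.im - q.re * p.im : ℝ) : ℂ) with hDdef
  have hD : D ≠ 0 := by rw [hDdef]; exact_mod_cast h
  set p' : ℂ := p.re - Complex.I * p.im with hp'
  set q' : ℂ := q.re - Complex.I * q.im with hq'
  have hp : p = p.re + Complex.I * p.im := by rw [mul_comm]; exact (Complex.re_add_im p).symm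
  have hq : q = q.re + Complex.I * q.im := by rw [mul_comm]; exact (Complex.re_add_im q).symm
  have hDI : p * q' - q * p' = -2 * Complex.I * D := by
    rw [hp', hq', hDdef]
    push_cast
    linear_combination (q.re - Complex.I * q.im) * hp - (p.re - Complex.I * p.im) * hq
  have hDI0 : p * q' - q * p' ≠ 0 := by
    rw [hDI]; simp [hD]
  -- The factor and its conjugate form a basis of the linear forms. The other factor becomes `l * u
  -- + m * v`, and `m = 0` is the case of a double nonreal factor.
  have expand : ∀ x y : ℂ, ∃ l m : ℂ, x = l * p + m * p' ∧ y = l * q + m * q' := fun x y =>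
    ⟨(x * q' - y * p') / (p * q' - q * p'), (p * y - q * x) / (p * q' - q * p'),
      by rw [div_mul_eq_mul_div, div_mul_eq_mul_div, ← add_div, eq_div_iff hDI0]; ring,
      by rw [div_mul_eq_mul_div, div_mul_eq_mul_div, ← add_div, eq_div_iff hDI0]; ring⟩
  obtain ⟨l, m, hr, hs⟩ := expand r s
  obtain ⟨d', e', hd, he⟩ := expand d e
  have hu : ∀ x y : ℂ, (p.re * x + q.re * y + 0) + Complex.I * (p.im * x + q.im * y + 0) =
      p * x + q * y := by
    intro x y
    linear_combination -x * hp - y * hq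
  have hv : ∀ x y : ℂ, (p.re * x + q.re * y + 0) - Complex.I * (p.im * x + q.im * y + 0) =
      p' * x + q' * y := by
    intro x y
    rw [hp', hq']
    ring
  by_cases hm : m = 0
  · have hl : l ≠ 0 := by
      rintro rfl
      exact hne ⟨by rw [hr, hm]; ring, by rw [hs, hm]; ring⟩
    have hb := isBounded_shadow_compl_of_sq (d' / l) (e' / l) (f / l)
    rw [(encard_parts_shadow_of_affine p.re q.re p.im q.im 0 0 h fun x y => ?_).1,
      unboundedParts_of_isBounded hb, encard_empty]
    beta_reduce
    rw [hu, hv]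
    refine (Eq.congr_left ?_).trans (mul_eq_zero_iff_left hl)
    rw [quadratic, hr, hs, hd, he, hm]
    field_simp
    ring
  · have hb := isBounded_shadow_compl_of_mul (l / m) (d' / m) (e' / m) (f / m)
    rw [(encard_parts_shadow_of_affine p.re q.re p.im q.im 0 0 h fun x y => ?_).1,
      unboundedParts_of_isBounded hb, encard_empty]
    beta_reduce
    rw [hu, hv]
    refine (Eq.congr_left ?_).trans (mul_eq_zero_iff_left hm)
    rw [quadratic, hr, hs, hd, he]
    field_simp
    ring

theorem encard_parts_shadow_mul (c : ℂ) :
    (unboundedParts (imaginaryShadow (fun z w => z * w - c))ᶜ).encard = 4 ∧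
      (conj c = c → (strictParts (imaginaryShadow (fun z w => z * w - c))ᶜ).encard ≤ 2) := by
  by_cases hc : c.im = 0
  · obtain ⟨r, rfl⟩ : ∃ r : ℝ, (r : ℂ) = c := ⟨c.re, Complex.ext (by simp) (by simp [hc])⟩
    rcases lt_trichotomy r 0 with h | rfl | h
    -- The reflection `w ↦ -w` exchanges `r` and `-r`.
    · have ht := encard_parts_shadow_of_affine (P := fun z w => z * w - (r : ℂ))
        (Q := fun z w => z * w - ((-r : ℝ) : ℂ)) 1 0 0 (-1) 0 0 (by norm_num) (fun x y => by
          rw [← neg_eq_zero]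
          apply Eq.congr_left
          push_cast
          ring)
      have hp := encard_parts_shadow_mul_pos (neg_pos.2 h)
      exact ⟨ht.1.trans hp.1, fun _ => (ht.2.trans hp.2).le⟩
    · have h0 := encard_parts_shadow_mul_zero
      rw [Complex.ofReal_zero]
      exact ⟨h0.1, fun _ => h0.2⟩
    · have hp := encard_parts_shadow_mul_pos h
      exact ⟨hp.1, fun _ => hp.2.le⟩
  · exact ⟨(encard_parts_shadow_mul_im hc).1, fun h => absurd (Complex.conj_eq_iff_im.1 h) hc⟩

theorem encard_parts_shadow_sq (c : ℂ) :
    ((unboundedParts (imaginaryShadow (fun z _ => z ^ 2 - c))ᶜ).encard = 2 ∨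
      (unboundedParts (imaginaryShadow (fun z _ => z ^ 2 - c))ᶜ).encard = 3) ∧
      (strictParts (imaginaryShadow (fun z _ => z ^ 2 - c))ᶜ).encard ≤ 2 := by
  obtain ⟨r, rfl⟩ := IsAlgClosed.exists_pow_nat_eq c two_pos
  by_cases hr : r.im = 0
  · have h := encard_parts_shadow_sq_real hr
    exact ⟨Or.inl h, (strictParts_encard_le _).trans h.le⟩
  · have h := encard_parts_shadow_sq_nonreal hr
    exact ⟨Or.inr h.1, h.2⟩

theorem encard_parts_shadow_parabola {k : ℂ} (hk : k ≠ 0) :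
    (unboundedParts (imaginaryShadow (fun z w => w - k * z ^ 2))ᶜ).encard ≤ 2 ∧
      (conj k = k →
        (unboundedParts (imaginaryShadow (fun z w => w - k * z ^ 2))ᶜ).encard = 2) := by
  by_cases h : k.im = 0
  · obtain ⟨r, rfl⟩ : ∃ r : ℝ, (r : ℂ) = k := ⟨k.re, Complex.ext (by simp) (by simp [h])⟩
    have := encard_parts_shadow_parabola_re (k := r) (by exact_mod_cast hk)
    exact ⟨this.le, fun _ => this⟩
  · refine ⟨?_, fun h' => absurd (Complex.conj_eq_iff_im.1 h') h⟩
    rw [encard_parts_shadow_parabola_im h]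
    norm_num

theorem encard_parts_of_distinct_real_factors {k d e f : ℂ} {p q r s : ℝ} (hk : k ≠ 0)
    (hD : p * s - q * r ≠ 0) :
    let P := quadratic (k * (p * r)) (k * (p * s + q * r)) (k * (q * s)) d e f
    (unboundedParts (imaginaryShadow P)ᶜ).encard = 4 ∧
      (conj k = k → conj d = d → conj e = e → conj f = f →
        (strictParts (imaginaryShadow P)ᶜ).encard ≤ 2) := by
  intro P
  have hDc : (p * s - q * r : ℂ) ≠ 0 := by exact_mod_cast hD
  -- By Cramer's rule, `d'` and `e'` are the translations that absorb the linear terms into the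
  -- product of the two factors.
  set d' : ℂ := (d * s - e * r) / (k * (p * s - q * r)) with hd'
  set e' : ℂ := (p * e - q * d) / (k * (p * s - q * r)) with he'
  have hd : d = k * (d' * p + e' * r) := by
    rw [hd', he', div_mul_eq_mul_div, div_mul_eq_mul_div, ← add_div, mul_div_assoc',
      eq_div_iff (mul_ne_zero hk hDc)]
    ring
  have he : e = k * (d' * q + e' * s) := by
    rw [hd', he', div_mul_eq_mul_div, div_mul_eq_mul_div, ← add_div, mul_div_assoc',
      eq_div_iff (mul_ne_zero hk hDc)]
    ring
  have hf : f = k * (f / k) := (mul_div_cancel₀ f hk).symm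
  have ht := encard_parts_shadow_of_affine (P := P)
    (Q := fun z w => z * w - (d' * e' - f / k)) p q r s e' d' hD (fun x y => by
      refine (Eq.congr_left ?_).trans (mul_eq_zero_iff_left hk)
      simp only [P, quadratic]
      linear_combination x * hd + y * he + hf)
  have hm := encard_parts_shadow_mul (d' * e' - f / k)
  refine ⟨ht.1.trans hm.1, fun h1 h2 h3 h4 => ht.2.trans_le (hm.2 ?_)⟩
  rw [hd', he']
  simp only [map_sub, map_mul, map_div₀, Complex.conj_ofReal, h1, h2, h3, h4]

theorem encard_parts_of_double_real_factor {k d e f : ℂ} {p q : ℝ} (hk : k ≠ 0)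
    (hD : 0 < p ^ 2 + q ^ 2) :
    let P := quadratic (k * p ^ 2) (k * (2 * (p * q))) (k * q ^ 2) d e f
    (unboundedParts (imaginaryShadow P)ᶜ).encard ≤ 4 ∧
      (conj k = k → conj d = d → conj e = e → conj f = f →
        (unboundedParts (imaginaryShadow P)ᶜ).encard ≠ 1 ∧
          (strictParts (imaginaryShadow P)ᶜ).encard ≤ 2) := by
  intro P
  have hDc : (p ^ 2 + q ^ 2 : ℂ) ≠ 0 := by exact_mod_cast hD.ne'
  have hdet : p * p - q * (-q) ≠ 0 := by
    rw [show p * p - q * (-q) = p ^ 2 + q ^ 2 by ring]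
    exact hD.ne'
  -- The linear part is split along the repeated form `p * x + q * y` and the orthogonal form `-q *
  -- x + p * y`. Its component `e'` along the latter decides between parallel lines and a parabola.
  set d' : ℂ := (d * p + e * q) / (k * (p ^ 2 + q ^ 2)) with hd'
  set e' : ℂ := (p * e - q * d) / (k * (p ^ 2 + q ^ 2)) with he'
  have hd : d = k * (d' * p - e' * q) := by
    rw [hd', he', div_mul_eq_mul_div, div_mul_eq_mul_div, ← sub_div, mul_div_assoc',
      eq_div_iff (mul_ne_zero hk hDc)]
    ring
  have he : e = k * (d' * q + e' * p) := by
    rw [hd', he', div_mul_eq_mul_div, div_mul_eq_mul_div, ← add_div, mul_div_assoc',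
      eq_div_iff (mul_ne_zero hk hDc)]
    ring
  have hf : f = k * (f / k) := (mul_div_cancel₀ f hk).symm
  by_cases h0 : e' = 0
  · have ht := encard_parts_shadow_of_affine (P := P)
      (Q := fun z _ => z ^ 2 - (d' ^ 2 / 4 - f / k)) p q (-q) p (d' / 2) 0 hdet (fun x y => by
        refine (Eq.congr_left ?_).trans (mul_eq_zero_iff_left hk)
        simp only [P, quadratic]
        rw [h0] at hd he
        linear_combination x * hd + y * he + hf)
    have hm := encard_parts_shadow_sq (d' ^ 2 / 4 - f / k)
    rw [ht.1, ht.2]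
    refine ⟨?_, fun _ _ _ _ => ⟨?_, hm.2⟩⟩
    · rcases hm.1 with h | h <;> rw [h] <;> norm_num
    · rcases hm.1 with h | h <;> rw [h] <;> norm_num
  · have ht := encard_parts_shadow_of_affine (P := P)
      (Q := fun z w => w - (-1 / e') * z ^ 2) p q (-q) p (d' / 2) ((f / k - d' ^ 2 / 4) / e') hdet
      (fun x y => by
        refine (Eq.congr_left ?_).trans (mul_eq_zero_iff_left (mul_ne_zero hk h0))
        simp only [P, quadratic]
        have h1 : e' * (1 / e') = 1 := mul_one_div_cancel h0
        push_cast
        linear_combination x * hd + y * he + hf - k * ((p * x + q * y + d' / 2) ^ 2 +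
          (f / k - d' ^ 2 / 4)) * h1)
    have hm := encard_parts_shadow_parabola (k := -1 / e') (div_ne_zero (by norm_num) h0)
    rw [ht.1, ht.2]
    refine ⟨hm.1.trans (by norm_num), fun h1 h2 h3 _ => ?_⟩
    have h2 := hm.2 (by
      rw [he']
      simp only [map_sub, map_mul, map_div₀, map_neg, map_one, map_add, map_pow,
        Complex.conj_ofReal, h1, h2, h3])
    rw [h2]
    exact ⟨by norm_num, (strictParts_encard_le _).trans h2.le⟩

theorem encard_parts_quadratic {a b c d e f : ℂ} (hne : ¬ (a = 0 ∧ b = 0 ∧ c = 0)) :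
    let S := (imaginaryShadow (quadratic a b c d e f))ᶜ
    (unboundedParts S).encard ≤ 4 ∧
      (conj a = a → conj b = b → conj c = c → conj d = d → conj e = e → conj f = f →
        (unboundedParts S).encard ≠ 1 ∧ (strictParts S).encard ≤ 2) := by
  intro S
  have hzero : (unboundedParts S).encard = 0 → (unboundedParts S).encard ≤ 4 ∧
      (conj a = a → conj b = b → conj c = c → conj d = d → conj e = e → conj f = f →
        (unboundedParts S).encard ≠ 1 ∧ (strictParts S).encard ≤ 2) := fun h => by
    rw [h]
    exact ⟨by norm_num, fun _ _ _ _ _ _ =>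
      ⟨by norm_num, (strictParts_encard_le _).trans (by rw [h]; norm_num)⟩⟩
  obtain ⟨p, q, r, s, ha, hb, hc⟩ := exists_linear_factors a b c
  have hpq : ¬ (p = 0 ∧ q = 0) := by
    rintro ⟨rfl, rfl⟩
    exact hne ⟨by simp [ha], by simp [hb], by simp [hc]⟩
  have hrs : ¬ (r = 0 ∧ s = 0) := by
    rintro ⟨rfl, rfl⟩
    exact hne ⟨by simp [ha], by simp [hb], by simp [hc]⟩
  by_cases h1 : p.re * q.im - q.re * p.im = 0
  swap
  · apply hzero
    have := encard_parts_of_nonreal_factor (d := d) (e := e) (f := f) h1 hrs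
    rwa [← ha, ← hb, ← hc] at this
  by_cases h2 : r.re * s.im - s.re * r.im = 0
  swap
  · apply hzero
    have := encard_parts_of_nonreal_factor (d := d) (e := e) (f := f) h2 hpq
    rwa [mul_comm r p, ← ha, show r * q + s * p = b by rw [hb]; ring, mul_comm s q, ← hc] at this
  obtain ⟨k, p', q', hk, rfl, rfl, hpq'⟩ := exists_real_multiple h1 hpq
  obtain ⟨l, r', s', hl, rfl, rfl, hrs'⟩ := exists_real_multiple h2 hrs
  have hkl := mul_ne_zero hk hl
  have ha' : a = k * l * (p' * r') := by rw [ha]; ring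
  have hb' : b = k * l * (p' * s' + q' * r') := by rw [hb]; ring
  have hc' : c = k * l * (q' * s') := by rw [hc]; ring
  -- The scalars `k` and `l` need not be real separately. Reality of the overall scalar is read off
  -- from a nonzero leading coefficient.
  have hreal : ∀ (m : ℂ) (t : ℝ) (x : ℂ), x ≠ 0 → x = m * t → conj x = x → conj m = m := by
    rintro m t x hx rfl h
    rw [map_mul, Complex.conj_ofReal] at h
    exact mul_right_cancel₀ (right_ne_zero_of_mul hx) h
  by_cases hD : p' * s' - q' * r' = 0
  · obtain ⟨t, ht⟩ : ∃ t : ℝ, r' = t * p' ∧ s' = t * q' := by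
      refine ⟨(r' * p' + s' * q') / (p' ^ 2 + q' ^ 2), ?_, ?_⟩
      · rw [div_mul_eq_mul_div, eq_div_iff hpq'.ne']
        linear_combination -q' * hD
      · rw [div_mul_eq_mul_div, eq_div_iff hpq'.ne']
        linear_combination p' * hD
    have ht0 : t ≠ 0 := by
      rintro rfl
      rw [ht.1, ht.2] at hrs'
      simp at hrs'
    obtain ⟨rfl, rfl⟩ := ht
    have key := encard_parts_of_double_real_factor (k := k * l * t) (d := d) (e := e) (f := f)
      (mul_ne_zero hkl (by exact_mod_cast ht0)) hpq'
    rw [show k * l * t * (p' : ℂ) ^ 2 = a by rw [ha']; push_cast; ring,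
      show k * l * t * (2 * (p' * q') : ℂ) = b by rw [hb']; push_cast; ring,
      show k * l * t * (q' : ℂ) ^ 2 = c by rw [hc']; push_cast; ring] at key
    refine ⟨key.1, fun ca cb cc cd ce cf => key.2 ?_ cd ce cf⟩
    by_cases hp : p' = 0
    · refine hreal (k * l * t) (q' ^ 2) c (fun h0 => ?_) (by rw [hc']; push_cast; ring) cc
      refine hne ⟨by rw [ha', hp]; simp, by rw [hb', hp]; simp, h0⟩
    · refine hreal (k * l * t) (p' ^ 2) a ?_ (by rw [ha']; push_cast; ring) ca
      rw [ha']
      have : (p' : ℂ) ≠ 0 := by exact_mod_cast hp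
      have : (t : ℂ) ≠ 0 := by exact_mod_cast ht0
      push_cast
      simp [*]
  · have key := encard_parts_of_distinct_real_factors (d := d) (e := e) (f := f) hkl hD
    rw [← ha', ← hb', ← hc'] at key
    refine ⟨key.1.le, fun ca cb cc cd ce cf => ⟨?_, key.2 ?_ cd ce cf⟩⟩
    · have h4 := key.1
      change (unboundedParts S).encard = 4 at h4
      rw [h4]
      norm_num
    · by_cases h0 : a = 0
      · by_cases h0' : b = 0
        · exact hreal _ (q' * s') c (fun h => hne ⟨h0, h0', h⟩) (by rw [hc']; push_cast; ring) cc
        · exact hreal _ (p' * s' + q' * r') b h0' (by rw [hb']; push_cast; ring) cb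
      · exact hreal _ (p' * r') a h0 (by rw [ha']; push_cast; ring) ca

/-! ### Passing between polynomials and their six coefficients -/

/-- The exponent vector of `z ^ i * w ^ j`. -/
noncomputable def bivariateExponent (i j : ℕ) : Fin 2 →₀ ℕ :=
  Finsupp.single 0 i + Finsupp.single 1 j

theorem bivariateExponent_zero (i j : ℕ) : bivariateExponent i j 0 = i := by
  simp [bivariateExponent]

theorem bivariateExponent_one (i j : ℕ) : bivariateExponent i j 1 = j := by
  simp [bivariateExponent]

theorem bivariateExponent_inj {i j k l : ℕ} :
    bivariateExponent i j = bivariateExponent k l ↔ i = k ∧ j = l := by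
  refine ⟨fun h => ⟨?_, ?_⟩, fun h => by rw [h.1, h.2]⟩
  · rw [← bivariateExponent_zero i j, h, bivariateExponent_zero]
  · rw [← bivariateExponent_one i j, h, bivariateExponent_one]

theorem bivariateExponent_apply (m : Fin 2 →₀ ℕ) : bivariateExponent (m 0) (m 1) = m := by
  ext i
  fin_cases i
  · exact bivariateExponent_zero _ _
  · exact bivariateExponent_one _ _

theorem degree_eq_fin_two (m : Fin 2 →₀ ℕ) : (m.sum fun _ e => e) = m 0 + m 1 := by
  rw [Finsupp.sum_fintype _ _ (fun _ => rfl), Fin.sum_univ_two]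

theorem imaginaryProjection_eq_shadow (p : MvPolynomial (Fin 2) ℂ) :
    imaginaryProjection p = imaginaryShadow fun z w => eval ![z, w] p := by
  ext y
  constructor
  · rintro ⟨z, hz, rfl⟩
    refine ⟨z 0, z 1, ?_, rfl, rfl⟩
    beta_reduce
    rw [show ![z 0, z 1] = z from by ext i; fin_cases i <;> rfl]
    exact hz
  · rintro ⟨z, w, h, h0, h1⟩
    refine ⟨![z, w], h, ?_⟩
    ext i
    fin_cases i
    · exact h0
    · exact h1

theorem IsComplexConic.eval_eq {p : MvPolynomial (Fin 2) ℂ} (hp : IsComplexConic p) (z w : ℂ) :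
    eval ![z, w] p = quadratic (p.coeff (bivariateExponent 2 0)) (p.coeff (bivariateExponent 1 1))
      (p.coeff (bivariateExponent 0 2)) (p.coeff (bivariateExponent 1 0))
      (p.coeff (bivariateExponent 0 1)) (p.coeff (bivariateExponent 0 0)) z w := by
  classical
  set T : Finset (ℕ × ℕ) := {(2, 0), (1, 1), (0, 2), (1, 0), (0, 1), (0, 0)} with hT
  have hsub : p.support ⊆ T.image fun t => bivariateExponent t.1 t.2 := by
    intro m hm
    have hle := le_totalDegree hm
    rw [hp, degree_eq_fin_two] at hle
    refine Finset.mem_image.2 ⟨(m 0, m 1), ?_, bivariateExponent_apply m⟩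
    have h0 : m 0 ≤ 2 := by omega
    have h1 : m 1 ≤ 2 := by omega
    generalize m 0 = i at *
    generalize m 1 = j at *
    interval_cases i <;> interval_cases j <;> first | omega | simp [hT]
  rw [eval_eq', Finset.sum_subset hsub (fun m _ hm => by
    rw [notMem_support_iff.1 hm, zero_mul]), Finset.sum_image (fun s _ t _ h => by
      rw [bivariateExponent_inj] at h
      exact Prod.ext h.1 h.2)]
  rw [hT]
  simp [Fin.prod_univ_two, bivariateExponent_zero, bivariateExponent_one, quadratic]
  ring

theorem IsComplexConic.exists_coeff_ne_zero {p : MvPolynomial (Fin 2) ℂ} (hp : IsComplexConic p) :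
    ¬ (p.coeff (bivariateExponent 2 0) = 0 ∧ p.coeff (bivariateExponent 1 1) = 0 ∧
      p.coeff (bivariateExponent 0 2) = 0) := by
  rintro ⟨h0, h1, h2⟩
  have hle : p.totalDegree ≤ 1 := by
    refine Finset.sup_le fun m hm => ?_
    have hle := le_totalDegree hm
    rw [hp, degree_eq_fin_two] at hle
    rw [degree_eq_fin_two]
    by_contra hlt
    have hcases : (m 0 = 2 ∧ m 1 = 0) ∨ (m 0 = 1 ∧ m 1 = 1) ∨ (m 0 = 0 ∧ m 1 = 2) := by omega
    rw [mem_support_iff, ← bivariateExponent_apply m] at hm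
    rcases hcases with ⟨e0, e1⟩ | ⟨e0, e1⟩ | ⟨e0, e1⟩ <;> rw [e0, e1] at hm <;> exact hm ‹_›
  rw [hp] at hle
  omega

theorem IsComplexConic.encard_parts {p : MvPolynomial (Fin 2) ℂ} (hp : IsComplexConic p) :
    (unboundedComponents p).encard ≤ 4 ∧ (IsRealConic p → (unboundedComponents p).encard ≠ 1 ∧
      (strictlyConvexUnboundedComponents p).encard ≤ 2) := by
  have heq : imaginaryProjection p = imaginaryShadow (quadratic (p.coeff (bivariateExponent 2 0))
      (p.coeff (bivariateExponent 1 1)) (p.coeff (bivariateExponent 0 2))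
      (p.coeff (bivariateExponent 1 0)) (p.coeff (bivariateExponent 0 1))
      (p.coeff (bivariateExponent 0 0))) := by
    rw [imaginaryProjection_eq_shadow]
    congr 1
    funext z w
    exact hp.eval_eq z w
  have key := encard_parts_quadratic (d := p.coeff (bivariateExponent 1 0))
    (e := p.coeff (bivariateExponent 0 1)) (f := p.coeff (bivariateExponent 0 0))
    hp.exists_coeff_ne_zero
  have hu : unboundedComponents p = unboundedParts (imaginaryProjection p)ᶜ := rfl
  have hs : strictlyConvexUnboundedComponents p = strictParts (imaginaryProjection p)ᶜ := rfl
  rw [hu, hs, heq]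
  refine ⟨key.1, fun hr => ?_⟩
  have hc : ∀ m, conj (p.coeff m) = p.coeff m := fun m => Complex.conj_eq_iff_im.2 (hr.2 m)
  exact key.2 (hc _) (hc _) (hc _) (hc _) (hc _) (hc _)

theorem exists_conic_shadow (a b c d e f : ℂ) (hne : ¬ (a = 0 ∧ b = 0 ∧ c = 0)) :
    ∃ p : MvPolynomial (Fin 2) ℂ, IsComplexConic p ∧
      imaginaryProjection p = imaginaryShadow (quadratic a b c d e f) ∧
      (a.im = 0 → b.im = 0 → c.im = 0 → d.im = 0 → e.im = 0 → f.im = 0 → IsRealConic p) := by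
  classical
  set p : MvPolynomial (Fin 2) ℂ := monomial (bivariateExponent 2 0) a +
    monomial (bivariateExponent 1 1) b + monomial (bivariateExponent 0 2) c +
    monomial (bivariateExponent 1 0) d + monomial (bivariateExponent 0 1) e +
    monomial (bivariateExponent 0 0) f with hp
  have hmon : ∀ (i j : ℕ) (x : ℂ), i + j ≤ 2 →
      (monomial (bivariateExponent i j) x).totalDegree ≤ 2 := by
    intro i j x h
    refine (totalDegree_monomial_le _ _).trans ((degree_eq_fin_two _).trans_le ?_)
    rw [bivariateExponent_zero, bivariateExponent_one]
    exact h
  have hle : p.totalDegree ≤ 2 := by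
    have hadd : ∀ q r : MvPolynomial (Fin 2) ℂ, q.totalDegree ≤ 2 → r.totalDegree ≤ 2 →
        (q + r).totalDegree ≤ 2 := fun q r hq hr => (totalDegree_add q r).trans (max_le hq hr)
    exact hadd _ _ (hadd _ _ (hadd _ _ (hadd _ _ (hadd _ _ (hmon _ _ _ (by norm_num))
      (hmon _ _ _ (by norm_num))) (hmon _ _ _ (by norm_num))) (hmon _ _ _ (by norm_num)))
      (hmon _ _ _ (by norm_num))) (hmon _ _ _ (by norm_num))
  have hge : ∀ i j, i + j = 2 → p.coeff (bivariateExponent i j) ≠ 0 → 2 ≤ p.totalDegree := by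
    intro i j hij h
    have := le_totalDegree (mem_support_iff.2 h)
    rw [degree_eq_fin_two, bivariateExponent_zero, bivariateExponent_one, hij] at this
    exact this
  have hconic : IsComplexConic p := by
    refine le_antisymm hle ?_
    by_cases ha : a = 0
    · by_cases hb : b = 0
      · have hc : c ≠ 0 := fun hc => hne ⟨ha, hb, hc⟩
        exact hge 0 2 rfl (by simpa [hp, coeff_monomial, bivariateExponent_inj] using hc)
      · exact hge 1 1 rfl (by simpa [hp, coeff_monomial, bivariateExponent_inj] using hb)
    · exact hge 2 0 rfl (by simpa [hp, coeff_monomial, bivariateExponent_inj] using ha)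
  refine ⟨p, hconic, ?_, fun ha hb hc hd he hf => ⟨hconic, fun m => ?_⟩⟩
  · rw [imaginaryProjection_eq_shadow]
    congr 1
    funext z w
    rw [hconic.eval_eq]
    simp [hp, coeff_monomial, bivariateExponent_inj]
  · rw [hp]
    simp only [coeff_add, coeff_monomial, Complex.add_im]
    split_ifs <;> simp [*]

theorem exists_conic_of_shadow {Q : ℂ → ℂ → ℂ} (a b c d e f : ℂ)
    (hne : ¬ (a = 0 ∧ b = 0 ∧ c = 0)) (hQ : ∀ z w, Q z w = quadratic a b c d e f z w) :
    ∃ p : MvPolynomial (Fin 2) ℂ, IsComplexConic p ∧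
      unboundedComponents p = unboundedParts (imaginaryShadow Q)ᶜ ∧
      strictlyConvexUnboundedComponents p = strictParts (imaginaryShadow Q)ᶜ ∧
      (a.im = 0 → b.im = 0 → c.im = 0 → d.im = 0 → e.im = 0 → f.im = 0 → IsRealConic p) := by
  obtain ⟨p, hp, h, hr⟩ := exists_conic_shadow a b c d e f hne
  have h' : imaginaryProjection p = imaginaryShadow Q :=
    h.trans (congrArg imaginaryShadow (funext fun z => funext fun w => (hQ z w).symm))
  refine ⟨p, hp, ?_, ?_, hr⟩
  · rw [← h']
    rfl
  · rw [← h']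
    rfl

/-! ### Extremal examples and conclusion -/

/-- The witnesses for 0, 2, 3, 4 are `z ^ 2 + w ^ 2` (the product `u * v`), `z ^ 2`, `z ^ 2 + 1` and
`z * w`. -/
theorem exists_realConic_encard {k : ℕ∞} (hk : k ≤ 4) (hk1 : k ≠ 1) :
    ∃ p : MvPolynomial (Fin 2) ℂ, IsRealConic p ∧ (unboundedComponents p).encard = k := by
  lift k to ℕ using ne_top_of_le_ne_top (by norm_num) hk
  have hk' : k ≤ 4 := by exact_mod_cast hk
  have hk1' : k ≠ 1 := by exact_mod_cast hk1
  interval_cases k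
  · obtain ⟨p, hp, hu, -, hr⟩ := exists_conic_of_shadow (Q := fun z w =>
      (fun u v => u * (0 * u + v) + 0 * u + 0 * v + 0) (z + Complex.I * w) (z - Complex.I * w))
      1 0 1 0 0 0 (by simp) (fun z w => by
        simp only [quadratic]
        linear_combination -w ^ 2 * Complex.I_sq)
    refine ⟨p, hr rfl rfl rfl rfl rfl rfl, ?_⟩
    rw [hu, unboundedParts_of_isBounded (isBounded_shadow_compl_of_mul 0 0 0 0)]
    simp
  · exact absurd rfl hk1'
  · obtain ⟨p, hp, hu, -, hr⟩ := exists_conic_of_shadow (Q := fun z _ => z ^ 2 - 0 ^ 2)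
      1 0 0 0 0 0 (by simp) (fun z w => by simp [quadratic])
    refine ⟨p, hr rfl rfl rfl rfl rfl rfl, ?_⟩
    rw [hu]
    exact encard_parts_shadow_sq_real rfl
  · obtain ⟨p, hp, hu, -, hr⟩ := exists_conic_of_shadow (Q := fun z _ => z ^ 2 - Complex.I ^ 2)
      1 0 0 0 0 1 (by simp) (fun z w => by simp [quadratic])
    refine ⟨p, hr rfl rfl rfl rfl rfl rfl, ?_⟩
    rw [hu]
    exact (encard_parts_shadow_sq_nonreal (r := Complex.I) (by simp)).1
  · obtain ⟨p, hp, hu, -, hr⟩ := exists_conic_of_shadow (Q := fun z w => z * w - 0)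
      0 1 0 0 0 0 (by simp) (fun z w => by simp [quadratic])
    refine ⟨p, hr rfl rfl rfl rfl rfl rfl, ?_⟩
    rw [hu]
    exact encard_parts_shadow_mul_zero.1

theorem corollary5p6 :
    ({k : ℕ∞ | ∃ p : MvPolynomial (Fin 2) ℂ,
        IsComplexConic p ∧ (unboundedComponents p).encard = k} = {k | k ≤ 4} ∧
      IsGreatest {m : ℕ∞ | ∃ p : MvPolynomial (Fin 2) ℂ,
        IsComplexConic p ∧ (strictlyConvexUnboundedComponents p).encard = m} 4) ∧
    ({k : ℕ∞ | ∃ p : MvPolynomial (Fin 2) ℂ,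
        IsRealConic p ∧ (unboundedComponents p).encard = k} = {k | k ≤ 4 ∧ k ≠ 1} ∧
      IsGreatest {m : ℕ∞ | ∃ p : MvPolynomial (Fin 2) ℂ,
        IsRealConic p ∧ (strictlyConvexUnboundedComponents p).encard = m} 2) := by
  refine ⟨⟨?_, ?_, ?_⟩, ?_, ?_, ?_⟩
  · ext k
    constructor
    · rintro ⟨p, hp, rfl⟩
      exact hp.encard_parts.1
    · intro hk
      by_cases hk1 : k = 1
      · subst hk1
        -- The value 1 comes from a parabola with nonreal leading coefficient.
        obtain ⟨p, hp, hu, -, -⟩ := exists_conic_of_shadow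
          (Q := fun z w => w - Complex.I * z ^ 2) (-Complex.I) 0 0 0 1 0 (by simp)
          (fun z w => by simp only [quadratic]; ring)
        exact ⟨p, hp, by rw [hu]; exact encard_parts_shadow_parabola_im (by simp)⟩
      · obtain ⟨p, hp, hu⟩ := exists_realConic_encard hk hk1
        exact ⟨p, hp.1, hu⟩
  · obtain ⟨p, hp, -, hs, -⟩ := exists_conic_of_shadow (Q := fun z w => z * w - Complex.I)
      0 1 0 0 0 (-Complex.I) (by simp) (fun z w => by simp only [quadratic]; ring)
    exact ⟨p, hp, by rw [hs]; exact (encard_parts_shadow_mul_im (by simp)).2⟩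
  · rintro m ⟨p, hp, rfl⟩
    exact (encard_le_encard (sep_subset _ _)).trans hp.encard_parts.1
  · ext k
    constructor
    · rintro ⟨p, hp, rfl⟩
      exact ⟨hp.1.encard_parts.1, (hp.1.encard_parts.2 hp).1⟩
    · rintro ⟨hk, hk1⟩
      exact exists_realConic_encard hk hk1
  · obtain ⟨p, hp, -, hs, hr⟩ := exists_conic_of_shadow (Q := fun z w => z * w - ((1 : ℝ) : ℂ))
      0 1 0 0 0 (-1) (by simp) (fun z w => by simp only [quadratic]; push_cast; ring)
    exact ⟨p, hr rfl rfl rfl rfl rfl (by simp), by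
      rw [hs]; exact (encard_parts_shadow_mul_pos one_pos).2⟩
  · rintro m ⟨p, hp, rfl⟩
    exact (hp.1.encard_parts.2 hp).2
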